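/- For $E=\mathbb{R}^d$ or $E=\mathbb{R}^d\times\mathbb{R}^d$, let $\mathrm{M}_0(E)$ be the set of nonnegative Borel measures on $E\setminus\{0\}$ that are finite on every Borel set $B$ bounded away from the origin ($0\notin\operatorname{cl}B$), with the weakest topology making $\mu\mapsto\int f\,d\mu$ continuous for every bounded continuous $f:E\setminus\{0\}\to\mathbb{R}$ vanishing on a neighbourhood of $0$; $\mu_n\xrightarrow{0}\mu$ denotes convergence in this topology. The support $\operatorname{spt}\mu\subset E$ of $\mu\in\mathrm{M}_0(E)$ is the usual support of its extension to $E$ that gives mass $0$ to $\{0\}$. For $\mu,\nu\in\mathrm{M}_0(\mathbb{R}^d)$, let $\Gamma_0(\mu,\nu)$ be the set of zero-couplings of $\mu$ and $\nu$, i.e. of Borel measures $\gamma$ on $(\mathbb{R}^d\times\mathbb{R}^d)\setminus\{0\}$ with $\gamma(A\times\mathbb{R}^d)=\mu(A)$ and $\gamma(\mathbb{R}^d\times A)=\nu(A)$ for all Borel $A\subset\mathbb{R}^d\setminus\{0\}$ (such $\gamma$ automatically lie in $\mathrm{M}_0(\mathbb{R}^d\times\mathbb{R}^d)$). A set $T\subset\mathbb{R}^d\times\mathbb{R}^d$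 is cyclically monotone if $\sum_{i=1}^m\langle x_i,y_i\rangle\ge\sum_{i=1}^m\langle x_i,y_{i+1}\rangle$ for all $m\ge1$ and $(x_1,y_1),\dots,(x_m,y_m)\in T$, where $y_{m+1}:=y_1$. Let $\Gamma_{0,\mathrm{cm}}(\mu,\nu)$ be the set of $\gamma\in\Gamma_0(\mu,\nu)$ with cyclically monotone support, and $\mathcal{F}_{\mathrm{mcm}}$ the collection of (necessarily closed) cyclically monotone subsets of $\mathbb{R}^d\times\mathbb{R}^d$ that are maximal with respect to inclusion. For a topological space $X$, the Fell topology on the collection $\mathcal{F}(X)$ of closed subsets of $X$ is generated by the sets $\{F: F\cap G\neq\emptyset\}$ ($G\subset X$ open) and $\{F:F\cap K=\emptyset\}$ ($K\subset X$ compact). For $V\subset\mathbb{R}^d$ and $T\subset\mathbb{R}^d\times\mathbb{R}^d$, write $T\llcorner V=T\cap(V\times\mathbb{R}^d)$. **Corollary.** Let $\mu_n,\nu_n,\mu,\nu\in\mathrm{M}_0(\mathbb{R}^d)$ with $\mu_n\xrightarrow{0}\mu$ and $\nu_n\xrightarrow{0}\nu$. For every $n\in\mathbb{N}$ let $\gamma_n\in\Gamma_{0,\mathrm{cm}}(\mu_n,\nu_n)$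 and $T_n\in\mathcal{F}_{\mathrm{mcm}}$ satisfy $\operatorname{spt}\gamma_n\subset T_n$. Assume that there exist $\gamma\in\mathrm{M}_0(\mathbb{R}^d\times\mathbb{R}^d)$ and $T\in\mathcal{F}_{\mathrm{mcm}}$ with $\Gamma_{0,\mathrm{cm}}(\mu,\nu)=\{\gamma\}$ and $\operatorname{spt}\gamma\subset T$. Then, with $V=\operatorname{int}(\operatorname{spt}\mu)$, along the whole sequence $n\to\infty$, $$\gamma_n\xrightarrow{0}\gamma\ \text{ in } \mathrm{M}_0(\mathbb{R}^d\times\mathbb{R}^d)\qquad\text{and}\qquad T_n\llcorner V\to T\llcorner V\ \text{ in the Fell topology of }\mathcal{F}(V\times\mathbb{R}^d).$$ -/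

import Mathlib

open MeasureTheory Filter Topology TopologicalSpace

namespace ZeroCoupling

/-- The punctured space `E \ {0}`. -/
abbrev Punctured (E : Type*) [Zero E] : Type _ := {x : E // x ≠ 0}

/-- `M₀(E)`: the nonnegative Borel measures on `E \ {0}` that are finite on the Borel sets
bounded away from the origin, i.e. on the Borel sets `B` with `0 ∉ closure B`. -/
structure M0 (E : Type*) [Zero E] [TopologicalSpace E] [MeasurableSpace E] where
  toMeasure : Measure (Punctured E)
  finite_away : ∀ B : Set E, MeasurableSet B → (0 : E) ∉ closure B →
    toMeasure (Subtype.val ⁻¹' B) < ⊤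

/-- `C₀(E)`: the bounded continuous real functions on `E \ {0}` that vanish on a neighbourhood
of the origin. -/
def testFunctions (E : Type*) [Zero E] [TopologicalSpace E] :
    Set (BoundedContinuousFunction (Punctured E) ℝ) :=
  {f | ∃ U ∈ 𝓝 (0 : E), ∀ x : Punctured E, x.1 ∈ U → f x = 0}

/-- The weakest topology on `M₀(E)` for which `μ ↦ ∫ f dμ` is continuous for every `f` in
`C₀(E)`. -/
noncomputable instance M0.instTopologicalSpace (E : Type*) [Zero E] [TopologicalSpace E] [MeasurableSpace E] :
    TopologicalSpace (M0 E) :=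
  ⨅ f : testFunctions E,
    TopologicalSpace.induced (fun μ : M0 E => ∫ x, f.1 x ∂μ.toMeasure) inferInstance

/-- The extension `μ̃` of a measure on `E \ {0}` to `E` with `μ̃({0}) = 0`. -/
noncomputable def extend {E : Type*} [Zero E] [MeasurableSpace E]
    (μ : Measure (Punctured E)) : Measure E :=
  μ.map Subtype.val

/-- The restriction `res m` to `E \ {0}` of a measure `m` on `E`. -/
noncomputable def res {E : Type*} [Zero E] [MeasurableSpace E]
    (m : Measure E) : Measure (Punctured E) :=
  m.comap Subtype.val

/-- The support of `μ ∈ M₀(E)`: the support in `E` of the extension `μ̃`.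
It may contain the origin. -/
noncomputable def M0.supp {E : Type*} [Zero E] [TopologicalSpace E] [MeasurableSpace E]
    (μ : M0 E) : Set E :=
  (extend μ.toMeasure).support

section Marginals

variable {E : Type*} [Zero E] [TopologicalSpace E] [MeasurableSpace E]

/-- The left zero-marginal: the measure `A ↦ γ (A × E)` on `E \ {0}`. -/
noncomputable def zeroMarginal₁ (γ : Measure (Punctured (E × E))) : Measure (Punctured E) :=
  res ((extend γ).map Prod.fst)

/-- The right zero-marginal: the measure `A ↦ γ (E × A)` on `E \ {0}`. -/
noncomputable def zeroMarginal₂ (γ : Measure (Punctured (E × E))) : Measure (Punctured E) :=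
  res ((extend γ).map Prod.snd)

/-- The set `Γ₀(μ, ν)` of zero-couplings between `μ` and `ν`.  That its elements are taken in
`M₀(E × E)` is no restriction, by `finite_away_of_zeroMarginals` below. -/
def zeroCouplings (μ ν : M0 E) : Set (M0 (E × E)) :=
  {γ | zeroMarginal₁ γ.toMeasure = μ.toMeasure ∧ zeroMarginal₂ γ.toMeasure = ν.toMeasure}

end Marginals

/-- A set `T ⊆ E × E` is cyclically monotone if `∑ ⟪xᵢ, yᵢ⟫ ≥ ∑ ⟪xᵢ, yᵢ₊₁⟫` for all
`(x₀, y₀), …, (xₙ, yₙ)` in `T`, with indices modulo `n + 1`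
(addition in `Fin (n + 1)` is cyclic). -/
def IsCyclicallyMonotone {E : Type*} [NormedAddCommGroup E] [InnerProductSpace ℝ E]
    (T : Set (E × E)) : Prop :=
  ∀ (n : ℕ) (p : Fin (n + 1) → E × E), (∀ i, p i ∈ T) →
    ∑ i, inner ℝ (p i).1 (p (i + 1)).2 ≤ ∑ i, inner ℝ (p i).1 (p i).2

/-- The set `Γ₀,cm(μ, ν)` of zero-couplings with cyclically monotone support. -/
def cmZeroCouplings {E : Type*} [NormedAddCommGroup E] [InnerProductSpace ℝ E]
    [MeasurableSpace E] (μ ν : M0 E) : Set (M0 (E × E)) :=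
  {γ | γ ∈ zeroCouplings μ ν ∧ IsCyclicallyMonotone γ.supp}

/-- The collection of (closed) maximal cyclically monotone subsets of `E × E`. -/
def mcmSets (E : Type*) [NormedAddCommGroup E] [InnerProductSpace ℝ E] : Set (Closeds (E × E)) :=
  {T | Maximal IsCyclicallyMonotone (T : Set (E × E))}

/-- The Fell hit-and-miss topology on the closed subsets of `X`. -/
abbrev fellTopology (X : Type*) [TopologicalSpace X] : TopologicalSpace (Closeds X) :=
  TopologicalSpace.generateFrom
    ({𝒰 | ∃ G : Set X, IsOpen G ∧ 𝒰 = {F : Closeds X | ((F : Set X) ∩ G).Nonempty}} ∪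
      {𝒰 | ∃ K : Set X, IsCompact K ∧ 𝒰 = {F : Closeds X | (F : Set X) ∩ K = ∅}})

/-- Convergence of a sequence of closed sets in the Fell topology. -/
def FellTendsto {X : Type*} [TopologicalSpace X] (F : ℕ → Closeds X) (L : Closeds X) : Prop :=
  Tendsto F atTop (@nhds _ (fellTopology X) L)

/-- The restriction `T ⌞ V = T ∩ (V × E)`, as a closed subset of the space `V × E`
(with its trace topology). -/
def restrictTo {E : Type*} [TopologicalSpace E] (T : Closeds (E × E)) (V : Set E) :
    Closeds (↥(V ×ˢ (Set.univ : Set E))) :=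
  ⟨Subtype.val ⁻¹' (T : Set (E × E)), T.isClosed.preimage continuous_subtype_val⟩

theorem M0.tendsto_iff {E : Type*} [Zero E] [TopologicalSpace E] [MeasurableSpace E]
    {μs : ℕ → M0 E} {μ : M0 E} :
    Tendsto μs atTop (𝓝 μ) ↔ ∀ f ∈ testFunctions E,
      Tendsto (fun n => ∫ x, f x ∂(μs n).toMeasure) atTop (𝓝 (∫ x, f x ∂μ.toMeasure)) := by
  rw [M0.instTopologicalSpace, nhds_iInf, tendsto_iInf]
  simp only [nhds_induced, tendsto_comap_iff, Subtype.forall, Function.comp_def]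

theorem fellTendsto_iff {X : Type*} [TopologicalSpace X] {F : ℕ → Closeds X} {L : Closeds X} :
    FellTendsto F L ↔
      (∀ G : Set X, IsOpen G → ((L : Set X) ∩ G).Nonempty →
        ∀ᶠ n in atTop, ((F n : Set X) ∩ G).Nonempty) ∧
      (∀ K : Set X, IsCompact K → (L : Set X) ∩ K = ∅ →
        ∀ᶠ n in atTop, (F n : Set X) ∩ K = ∅) := by
  rw [FellTendsto, fellTopology, tendsto_nhds_generateFrom_iff]
  constructor
  · intro h
    exact ⟨fun G hG hL => h _ (Or.inl ⟨G, hG, rfl⟩) hL,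
      fun K hK hL => h _ (Or.inr ⟨K, hK, rfl⟩) hL⟩
  · rintro ⟨h1, h2⟩ s (⟨G, hG, rfl⟩ | ⟨K, hK, rfl⟩) hL
    · exact h1 G hG hL
    · exact h2 K hK hL

section Facts

variable {E : Type*} [NormedAddCommGroup E] [MeasurableSpace E] [BorelSpace E]

theorem zeroMarginal₁_apply (γ : Measure (Punctured (E × E))) {A : Set (Punctured E)}
    (hA : MeasurableSet A) :
    zeroMarginal₁ γ A = γ (Subtype.val ⁻¹' ((Subtype.val '' A) ×ˢ (Set.univ : Set E))) := by
  have h0 : MeasurableSet {x : E | x ≠ 0} := (measurableSet_singleton (0 : E)).compl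
  have hA' : MeasurableSet (Subtype.val '' A : Set E) := h0.subtype_image hA
  rw [zeroMarginal₁, res, show ∀ m : Measure E, m.comap (Subtype.val : Punctured E → E) A =
      m (Subtype.val '' A) from fun m => (MeasurableEmbedding.subtype_coe h0).comap_apply m A,
    extend, Measure.map_apply measurable_fst hA',
    Measure.map_apply measurable_subtype_coe (measurable_fst hA'), Set.prod_univ]

theorem zeroMarginal₂_apply (γ : Measure (Punctured (E × E))) {A : Set (Punctured E)}
    (hA : MeasurableSet A) :
    zeroMarginal₂ γ A = γ (Subtype.val ⁻¹' ((Set.univ : Set E) ×ˢ (Subtype.val '' A))) := by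
  have h0 : MeasurableSet {x : E | x ≠ 0} := (measurableSet_singleton (0 : E)).compl
  have hA' : MeasurableSet (Subtype.val '' A : Set E) := h0.subtype_image hA
  rw [zeroMarginal₂, res, show ∀ m : Measure E, m.comap (Subtype.val : Punctured E → E) A =
      m (Subtype.val '' A) from fun m => (MeasurableEmbedding.subtype_coe h0).comap_apply m A,
    extend, Measure.map_apply measurable_snd hA',
    Measure.map_apply measurable_subtype_coe (measurable_snd hA'), Set.univ_prod]

/-- A measure on `(E × E) \ {0}` whose zero-marginals lie in `M₀(E)` lies in `M₀(E × E)`. -/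
theorem finite_away_of_zeroMarginals (μ ν : M0 E) (γ : Measure (Punctured (E × E)))
    (h₁ : zeroMarginal₁ γ = μ.toMeasure) (h₂ : zeroMarginal₂ γ = ν.toMeasure)
    (B : Set (E × E)) (hB : (0 : E × E) ∉ closure B) :
    γ (Subtype.val ⁻¹' B) < ⊤ := by
  have hn : (closure B)ᶜ ∈ 𝓝 ((0 : E), (0 : E)) := isClosed_closure.isOpen_compl.mem_nhds hB
  obtain ⟨U, hU, hU0, V, hV, hV0, hUV⟩ : ∃ U : Set E, IsOpen U ∧ (0 : E) ∈ U ∧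
      ∃ V : Set E, IsOpen V ∧ (0 : E) ∈ V ∧ U ×ˢ V ⊆ (closure B)ᶜ := by
    obtain ⟨U, V, hU, hU0, hV, hV0, h⟩ := mem_nhds_prod_iff'.1 hn
    exact ⟨U, hU, hU0, V, hV, hV0, h⟩
  have key : ∀ W : Set E, IsOpen W → (0 : E) ∈ W → MeasurableSet Wᶜ ∧ (0 : E) ∉ closure Wᶜ :=
    fun W hW h0 => ⟨hW.measurableSet.compl,
      by rwa [hW.isClosed_compl.closure_eq, Set.notMem_compl_iff]⟩
  have img : ∀ W : Set E, (0 : E) ∈ W →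
      Subtype.val '' ((Subtype.val : Punctured E → E) ⁻¹' Wᶜ) = Wᶜ := by
    intro W h0
    ext x
    constructor
    · rintro ⟨y, hy, rfl⟩
      exact hy
    · intro hx
      exact ⟨⟨x, fun h => hx (h ▸ h0)⟩, hx, rfl⟩
  have e1 := zeroMarginal₁_apply γ (measurable_subtype_coe (key U hU hU0).1)
  have e2 := zeroMarginal₂_apply γ (measurable_subtype_coe (key V hV hV0).1)
  rw [img U hU0, h₁] at e1
  rw [img V hV0, h₂] at e2
  have b1 := μ.finite_away _ (key U hU hU0).1 (key U hU hU0).2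
  have b2 := ν.finite_away _ (key V hV hV0).1 (key V hV hV0).2
  rw [e1] at b1
  rw [e2] at b2
  refine lt_of_le_of_lt (measure_mono ?_)
    (lt_of_le_of_lt (measure_union_le _ _) (ENNReal.add_lt_top.2 ⟨b1, b2⟩))
  intro p hp
  by_cases h : p.1.1 ∈ U
  · exact Or.inr ⟨trivial, fun h' => hUV ⟨h, h'⟩ (subset_closure hp)⟩
  · exact Or.inl ⟨h, trivial⟩

end Facts

end ZeroCoupling

/-! Everything is tested along ultrafilters finer than `atTop`. Zero-couplings of convergent
sequences have mass bounded away from the origin and tight at infinity, so they converge along every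
ultrafilter (`M0.exists_tendsto_of_tight`), and marginals pass to the limit. The limit's support
lies in the lower limit of the `Ts n`, which is cyclically monotone because a violated inequality
persists under small perturbations. Hence each limit belongs to `cmZeroCouplings μ ν = {γ}`, which
gives convergence of the whole sequence.

For the graphs, let `S = γ.supp`, a subset both of `T` and of the lower limit `L` of the `Ts n`.
Since `S` is closed and monotone and its first projection is dense in `interior μ.supp`, local
boundedness of monotone sets gives it a point over every `x` in that interior
(`IsCyclicallyMonotone.exists_mem_of_dense`). Over the interior this common part makes `T` and `L`
mutually monotone (`inner_sub_nonneg_of_common_subset`). Minty's theorem, obtained from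
Rockafellar's potential by minimising the potential plus a quadratic, supplies points of `T` and of
`Ts n` with any prescribed sum of coordinates. Two monotonically related points with equal
coordinate sums coincide, so `L` and `T` agree over the interior (`lowerLimit_inter_eq`).
Compactness turns this into Fell convergence. -/

namespace ZeroCoupling

/-! ### Cyclically monotone sets: Rockafellar's potential, Minty's theorem, local boundedness. -/

section CyclicMonotone

variable {E : Type*} [NormedAddCommGroup E] [InnerProductSpace ℝ E]

/-- The graph of the subdifferential of the function whose epigraph is `C`. -/
def subgradientGraph (C : Set (E × ℝ)) : Set (E × E) :=
  {p | ∃ t, (p.1, t) ∈ C ∧ ∀ q ∈ C, t + inner ℝ p.2 (q.1 - p.1) ≤ q.2}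

/-- Summed around a cycle, the subgradient inequalities lose their heights `t i`, which telescope.
-/
theorem isCyclicallyMonotone_subgradientGraph (C : Set (E × ℝ)) :
    IsCyclicallyMonotone (subgradientGraph C) := by
  intro n p hp
  choose t ht hsub using hp
  have h : ∀ i, inner ℝ (p i).1 (p (i + 1)).2 ≤
      inner ℝ (p (i + 1)).1 (p (i + 1)).2 + t i - t (i + 1) := by
    intro i
    have := hsub (i + 1) _ (ht i)
    rw [inner_sub_right, real_inner_comm _ (p (i + 1)).2, real_inner_comm _ (p (i + 1)).2] at this
    linarith
  have e : ∀ f : Fin (n + 1) → ℝ, ∑ i, f (i + 1) = ∑ i, f i :=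
    fun f => Equiv.sum_comp (Equiv.addRight 1) f
  calc ∑ i, inner ℝ (p i).1 (p (i + 1)).2
      ≤ ∑ i, (inner ℝ (p (i + 1)).1 (p (i + 1)).2 + t i - t (i + 1)) :=
        Finset.sum_le_sum fun i _ => h i
    _ = ∑ i, inner ℝ (p i).1 (p i).2 := by
        rw [Finset.sum_sub_distrib, Finset.sum_add_distrib, e t,
          e fun i => inner ℝ (p i).1 (p i).2]
        ring

/-- Rockafellar's affine minorant attached to a chain of points of `E × E`; the chain is
traversed from its last point to its first. -/
def chainValue {n : ℕ} (p : Fin (n + 1) → E × E) (v : E) : ℝ :=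
  inner ℝ (p 0).2 (v - (p 0).1) +
    ∑ i : Fin n, inner ℝ (p i.succ).2 ((p i.castSucc).1 - (p i.succ).1)

theorem chainValue_cons {n : ℕ} (q : E × E) (p : Fin (n + 1) → E × E) (v : E) :
    chainValue (Fin.cons q p : Fin (n + 2) → E × E) v =
      inner ℝ q.2 (v - q.1) + chainValue p q.1 := by
  simp only [chainValue, Fin.sum_univ_succ, Fin.cons_zero, Fin.cons_succ, Fin.castSucc_zero,
    Fin.castSucc_succ]

theorem IsCyclicallyMonotone.chainValue_last_nonpos {T : Set (E × E)}
    (hT : IsCyclicallyMonotone T) {n : ℕ} {p : Fin (n + 1) → E × E} (hp : ∀ i, p i ∈ T) :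
    chainValue p (p (Fin.last n)).1 ≤ 0 := by
  have h := hT n p hp
  have e : ∑ i, inner ℝ (p (i + 1)).1 (p (i + 1)).2 = ∑ i, inner ℝ (p i).1 (p i).2 :=
    Equiv.sum_comp (Equiv.addRight (1 : Fin (n + 1))) fun i => inner ℝ (p i).1 (p i).2
  rw [← e, Fin.sum_univ_castSucc, Fin.sum_univ_castSucc] at h
  simp only [Fin.coeSucc_eq_succ, Fin.last_add_one] at h
  simp only [chainValue, inner_sub_right, Finset.sum_sub_distrib, real_inner_comm] at h ⊢
  linarith

/-- The epigraph of the supremum of Rockafellar's affine minorants based at `p₀`. -/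
def chainEpigraph (T : Set (E × E)) (p₀ : E × E) : Set (E × ℝ) :=
  {q | ∀ (n : ℕ) (p : Fin (n + 1) → E × E), (∀ i, p i ∈ T) → p (Fin.last n) = p₀ →
    chainValue p q.1 ≤ q.2}

theorem isClosed_chainEpigraph (T : Set (E × E)) (p₀ : E × E) :
    IsClosed (chainEpigraph T p₀) := by
  simp only [chainEpigraph, Set.ofPred_forall]
  refine isClosed_iInter fun n => isClosed_iInter fun p => isClosed_iInter fun _ =>
    isClosed_iInter fun _ => isClosed_le ?_ continuous_snd
  unfold chainValue
  fun_prop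

theorem convex_chainEpigraph (T : Set (E × E)) (p₀ : E × E) :
    Convex ℝ (chainEpigraph T p₀) := by
  intro q hq r hr a b ha hb hab n p hp hl
  have h1 := mul_le_mul_of_nonneg_left (hq n p hp hl) ha
  have h2 := mul_le_mul_of_nonneg_left (hr n p hp hl) hb
  have hb' : b = 1 - a := by linarith
  subst hb'
  simp only [chainValue, inner_sub_right, Prod.fst_add, Prod.snd_add, Prod.smul_fst,
    Prod.smul_snd, inner_add_right, inner_smul_right, smul_eq_mul] at h1 h2 ⊢
  linarith

theorem IsCyclicallyMonotone.base_mem_chainEpigraph {T : Set (E × E)}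
    (hT : IsCyclicallyMonotone T) (p₀ : E × E) : (p₀.1, 0) ∈ chainEpigraph T p₀ := by
  intro n p hp hl
  simpa [hl] using hT.chainValue_last_nonpos hp

/-- Prepending `q` to a chain adds the affine term with slope `q.2` based at `q.1`. Hence the
supremum of the chain values at `q.1` is a height at which `q.2` is a subgradient; it is finite
because a chain extended by `q` has nonpositive value at the base point. -/
theorem IsCyclicallyMonotone.subset_subgradientGraph {T : Set (E × E)}
    (hT : IsCyclicallyMonotone T) {p₀ : E × E} (h₀ : p₀ ∈ T) :
    T ⊆ subgradientGraph (chainEpigraph T p₀) := by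
  intro q hq
  have hcons : ∀ {n : ℕ} {p : Fin (n + 1) → E × E}, (∀ i, p i ∈ T) →
      ∀ i, (Fin.cons q p : Fin (n + 2) → E × E) i ∈ T := by
    intro n p hp i
    refine Fin.cases ?_ (fun j => ?_) i
    · simpa using hq
    · simpa using hp j
  let A : Set ℝ := {r | ∃ (n : ℕ) (p : Fin (n + 1) → E × E), (∀ i, p i ∈ T) ∧
    p (Fin.last n) = p₀ ∧ r = chainValue p q.1}
  have hne : A.Nonempty := ⟨_, 0, fun _ => p₀, fun _ => h₀, rfl, rfl⟩
  have hbdd : BddAbove A := by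
    refine ⟨-inner ℝ q.2 (p₀.1 - q.1), ?_⟩
    rintro r ⟨n, p, hp, hl, rfl⟩
    have := hT.base_mem_chainEpigraph p₀ (n + 1) (Fin.cons q p) (hcons hp)
      (by rw [← Fin.succ_last, Fin.cons_succ, hl])
    rw [chainValue_cons] at this
    linarith
  refine ⟨sSup A, fun n p hp hl => le_csSup hbdd ⟨n, p, hp, hl, rfl⟩, fun s hs => ?_⟩
  rw [← le_sub_iff_add_le]
  refine csSup_le hne ?_
  rintro r ⟨n, p, hp, hl, rfl⟩
  have := hs (n + 1) (Fin.cons q p) (hcons hp) (by rw [← Fin.succ_last, Fin.cons_succ, hl])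
  rw [chainValue_cons] at this
  linarith

theorem isCyclicallyMonotone_singleton (p₀ : E × E) : IsCyclicallyMonotone {p₀} := by
  intro n p hp
  have h : ∀ i, p i = p₀ := hp
  simp [h]

theorem Maximal.nonempty_of_cyclicallyMonotone {T : Set (E × E)}
    (hT : Maximal IsCyclicallyMonotone T) : T.Nonempty := by
  by_contra h
  rw [Set.not_nonempty_iff_eq_empty] at h
  have := hT.le_of_ge (isCyclicallyMonotone_singleton (0 : E × E)) (by simp [h])
  simpa [h] using this rfl

/-- First-order optimality condition for `t + ‖w - z‖² / 2` on a convex set. -/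
theorem inner_le_of_isMinOn {C : Set (E × ℝ)} (hC : Convex ℝ C) {z : E} {q : E × ℝ}
    (hq : q ∈ C) (hmin : ∀ r ∈ C, q.2 + ‖q.1 - z‖ ^ 2 / 2 ≤ r.2 + ‖r.1 - z‖ ^ 2 / 2)
    {r : E × ℝ} (hr : r ∈ C) : q.2 + inner ℝ (z - q.1) (r.1 - q.1) ≤ r.2 := by
  by_contra! hlt
  set A : ℝ := r.2 - q.2 - inner ℝ (z - q.1) (r.1 - q.1) with hA
  set B : ℝ := ‖r.1 - q.1‖ ^ 2 / 2 with hB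
  have hA0 : A < 0 := by linarith
  have hB0 : 0 ≤ B := by positivity
  have key : ∀ l : ℝ, 0 ≤ l → l ≤ 1 → 0 ≤ l * A + l ^ 2 * B := by
    intro l hl0 hl1
    have hm := hmin _ (hC hq hr (sub_nonneg.2 hl1) hl0 (by ring))
    have e : ((1 - l) • q + l • r).1 - z = (q.1 - z) + l • (r.1 - q.1) := by
      simp only [Prod.fst_add, Prod.smul_fst]
      module
    rw [e, norm_add_sq_real, norm_smul, inner_smul_right, mul_pow, Real.norm_eq_abs, sq_abs,
      ← neg_sub z q.1, inner_neg_left] at hm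
    simp only [Prod.snd_add, Prod.smul_snd, smul_eq_mul] at hm
    rw [hA, hB]
    nlinarith [hm]
  have hBA : 0 < B - A := by linarith
  -- This `l` lies in `[0, 1]` and makes `l * A + l ^ 2 * B` equal to `A ^ 3 / (B - A) ^ 2`, which
  -- is negative.
  have h := key (-A / (B - A)) (div_nonneg (by linarith) hBA.le)
    ((div_le_one hBA).2 (by linarith))
  have e : -A / (B - A) * A + (-A / (B - A)) ^ 2 * B = A ^ 3 / (B - A) ^ 2 := by
    field_simp
    ring
  rw [e] at h
  have : A ^ 3 / (B - A) ^ 2 < 0 :=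
    div_neg_of_neg_of_pos (Odd.pow_neg (by decide) hA0) (by positivity)
  linarith

/-- The quadratic term dominates the affine minorant, so sublevel sets in `C` are compact. -/
theorem exists_isMinOn_add_sq [FiniteDimensional ℝ E] {C : Set (E × ℝ)} (hC : IsClosed C)
    (hne : C.Nonempty) {a : E} {b : ℝ} (hab : ∀ q ∈ C, inner ℝ a q.1 + b ≤ q.2) (z : E) :
    ∃ q ∈ C, ∀ r ∈ C, q.2 + ‖q.1 - z‖ ^ 2 / 2 ≤ r.2 + ‖r.1 - z‖ ^ 2 / 2 := by
  obtain ⟨q₀, h₀⟩ := hne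
  set g : E × ℝ → ℝ := fun q => q.2 + ‖q.1 - z‖ ^ 2 / 2 with hg
  have hgc : Continuous g := by fun_prop
  set K : ℝ := g q₀ - inner ℝ a z - b with hK
  -- A distance `s` to `z` in the sublevel set satisfies `s ^ 2 ≤ 2 * ‖a‖ * s + 2 * |K|`, impossible
  -- for `s > R`; the summand `1` forces `s > 1`.
  set R : ℝ := 2 * ‖a‖ + 2 * |K| + 1 with hR
  have hsub : C ∩ {q | g q ≤ g q₀} ⊆
      Metric.closedBall z R ×ˢ Set.Icc (inner ℝ a z - ‖a‖ * R + b) (g q₀) := by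
    rintro q ⟨hq, hle⟩
    have h1 := hab q hq
    have h2 : inner ℝ a q.1 = inner ℝ a z + inner ℝ a (q.1 - z) := by
      rw [← inner_add_right, add_sub_cancel]
    have h3 := (abs_le.1 (abs_real_inner_le_norm a (q.1 - z))).1
    have hle' : q.2 + ‖q.1 - z‖ ^ 2 / 2 ≤ g q₀ := hle
    have h4 : ‖q.1 - z‖ ≤ R := by
      by_contra! hlt
      have : ‖q.1 - z‖ ^ 2 ≤ 2 * ‖a‖ * ‖q.1 - z‖ + 2 * |K| := by
        linarith [le_abs_self K]
      nlinarith [norm_nonneg a, abs_nonneg K, norm_nonneg (q.1 - z)]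
    refine ⟨by simpa [dist_eq_norm] using h4, ?_, ?_⟩
    · have := mul_le_mul_of_nonneg_left h4 (norm_nonneg a)
      linarith
    · have : 0 ≤ ‖q.1 - z‖ ^ 2 / 2 := by positivity
      linarith
  have hcomp : IsCompact (C ∩ {q | g q ≤ g q₀}) :=
    ((isCompact_closedBall z R).prod isCompact_Icc).of_isClosed_subset
      (hC.inter (isClosed_le hgc continuous_const)) hsub
  obtain ⟨q, hq, hmin⟩ := hcomp.exists_isMinOn ⟨q₀, h₀, le_refl (g q₀)⟩ hgc.continuousOn
  refine ⟨q, hq.1, fun r hr => ?_⟩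
  by_cases h : g r ≤ g q₀
  · exact hmin ⟨hr, h⟩
  · exact hq.2.trans (not_le.1 h).le

/-- Minty's surjectivity for maximal cyclically monotone sets. -/
theorem Maximal.exists_mem_add_eq [FiniteDimensional ℝ E] {T : Set (E × E)}
    (hT : Maximal IsCyclicallyMonotone T) (z : E) : ∃ p ∈ T, p.1 + p.2 = z := by
  obtain ⟨p₀, h₀⟩ := Maximal.nonempty_of_cyclicallyMonotone hT
  set C := chainEpigraph T p₀
  have hab : ∀ q ∈ C, inner ℝ p₀.2 q.1 + -inner ℝ p₀.2 p₀.1 ≤ q.2 := by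
    intro q hq
    have := hq 0 (fun _ => p₀) (fun _ => h₀) rfl
    simp only [chainValue, inner_sub_right, Finset.univ_eq_empty, Finset.sum_empty] at this
    linarith
  obtain ⟨q, hq, hmin⟩ := exists_isMinOn_add_sq (isClosed_chainEpigraph T p₀)
    ⟨_, hT.prop.base_mem_chainEpigraph p₀⟩ hab z
  -- Optimality makes `z - q.1` a subgradient at `q.1`; by maximality `T` is the whole subgradient
  -- graph.
  refine ⟨(q.1, z - q.1), ?_, by simp⟩
  refine hT.le_of_ge (isCyclicallyMonotone_subgradientGraph C)
    (hT.prop.subset_subgradientGraph h₀) ?_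
  exact ⟨q.2, hq, fun r hr => inner_le_of_isMinOn (convex_chainEpigraph T p₀) hq hmin hr⟩

theorem IsCyclicallyMonotone.mono {S T : Set (E × E)} (hT : IsCyclicallyMonotone T)
    (h : S ⊆ T) : IsCyclicallyMonotone S :=
  fun n p hp => hT n p fun i => h (hp i)

theorem IsCyclicallyMonotone.inner_sub_nonneg {T : Set (E × E)} (hT : IsCyclicallyMonotone T)
    {p q : E × E} (hp : p ∈ T) (hq : q ∈ T) : 0 ≤ inner ℝ (p.1 - q.1) (p.2 - q.2) := by
  have h := hT 1 ![p, q] (by intro i; fin_cases i <;> simpa)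
  simp [Fin.sum_univ_two] at h
  simp only [inner_sub_left, inner_sub_right]
  linarith

/-- If a monotone set has a domain dense near `x`, it has no unbounded values near `x`. -/
theorem IsCyclicallyMonotone.not_tendsto_norm_snd [FiniteDimensional ℝ E] {S : Set (E × E)}
    (hS : IsCyclicallyMonotone S) {V : Set E} (hV : IsOpen V)
    (hVS : V ⊆ closure (Prod.fst '' S)) {x : E} (hx : x ∈ V) (𝒰 : Ultrafilter (E × E))
    (h𝒰S : S ∈ 𝒰) (h𝒰x : Tendsto Prod.fst (𝒰 : Filter (E × E)) (𝓝 x)) :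
    ¬ Tendsto (fun p : E × E => ‖p.2‖) 𝒰 atTop := by
  intro hinf
  obtain ⟨h, -, hh⟩ : ∃ h ∈ Metric.closedBall (0 : E) 1,
      Tendsto (fun p : E × E => ‖p.2‖⁻¹ • p.2) 𝒰 (𝓝 h) := by
    refine (isCompact_closedBall (0 : E) 1).ultrafilter_le_nhds
      (𝒰.map fun p : E × E => ‖p.2‖⁻¹ • p.2) ?_
    refine le_principal_iff.2 (Filter.mem_map.2 (Filter.univ_mem' fun p => ?_))
    simp only [Set.mem_preimage, mem_closedBall_zero_iff, norm_smul, norm_inv, norm_norm]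
    exact inv_mul_le_one
  have hh1 : ‖h‖ = 1 := by
    refine tendsto_nhds_unique hh.norm (tendsto_const_nhds.congr' ?_)
    filter_upwards [hinf.eventually_gt_atTop 0] with p hp
    rw [norm_smul, norm_inv, norm_norm, inv_mul_cancel₀ hp.ne']
  obtain ⟨ρ, hρ, hball⟩ := Metric.isOpen_iff.1 hV x hx
  -- A domain point `a` within `ρ / 4` of this one has `⟪a - x, h⟫ > 0`, while monotonicity divided
  -- by `‖p.2‖` gives `⟪a - x, h⟫ ≤ 0` in the limit.
  have hc : x + (ρ / 2) • h ∈ V := by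
    refine hball ?_
    rw [Metric.mem_ball, dist_eq_norm, add_sub_cancel_left, norm_smul, hh1, Real.norm_eq_abs,
      abs_of_pos (by positivity)]
    linarith
  obtain ⟨_, ⟨⟨a, b⟩, hab, rfl⟩, hdist⟩ :=
    Metric.mem_closure_iff.1 (hVS hc) (ρ / 4) (by positivity)
  have hpos : 0 < inner ℝ (a - x) h := by
    have e : a - x = (ρ / 2) • h + (a - (x + (ρ / 2) • h)) := by abel
    rw [e, inner_add_left, real_inner_smul_left, real_inner_self_eq_norm_sq, hh1]
    have h1 := (abs_le.1 (abs_real_inner_le_norm (a - (x + (ρ / 2) • h)) h)).1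
    rw [hh1, mul_one, ← dist_eq_norm, dist_comm] at h1
    simp only at hdist
    linarith
  have l1 : Tendsto (fun p : E × E => inner ℝ (a - p.1) (‖p.2‖⁻¹ • b)) 𝒰 (𝓝 0) := by
    have : Tendsto (fun p : E × E => inner ℝ (a - p.1) (‖p.2‖⁻¹ • b)) 𝒰
        (𝓝 (inner ℝ (a - x) ((0 : ℝ) • b))) :=
      (tendsto_const_nhds.sub h𝒰x).inner ((tendsto_inv_atTop_zero.comp hinf).smul_const b)
    simpa using this
  have l2 : Tendsto (fun p : E × E => inner ℝ (a - p.1) (‖p.2‖⁻¹ • p.2)) 𝒰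
      (𝓝 (inner ℝ (a - x) h)) := (tendsto_const_nhds.sub h𝒰x).inner hh
  have : inner ℝ (a - x) h ≤ 0 := by
    refine le_of_tendsto_of_tendsto l2 l1 ?_
    filter_upwards [h𝒰S] with p hp
    have := hS.inner_sub_nonneg hab hp
    simp only [inner_sub_right] at this
    rw [inner_smul_right, inner_smul_right]
    exact mul_le_mul_of_nonneg_left (by linarith) (by positivity)
  linarith

theorem IsCyclicallyMonotone.exists_mem_of_dense [FiniteDimensional ℝ E] {S : Set (E × E)}
    (hS : IsCyclicallyMonotone S) (hcl : IsClosed S) {V : Set E} (hV : IsOpen V)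
    (hVS : V ⊆ closure (Prod.fst '' S)) {x : E} (hx : x ∈ V) : ∃ y, (x, y) ∈ S := by
  have hne : (comap Prod.fst (𝓝 x) ⊓ 𝓟 S).NeBot := by
    rw [← Filter.map_neBot_iff (Prod.fst : E × E → E), inf_comm, Filter.push_pull,
      map_principal, inf_comm]
    exact ⟨mem_closure_iff_nhds_ne_bot.1 (hVS hx)⟩
  set 𝒰 := @Ultrafilter.of _ _ hne
  have hle : (𝒰 : Filter (E × E)) ≤ comap Prod.fst (𝓝 x) ⊓ 𝓟 S := @Ultrafilter.of_le _ _ hne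
  have h𝒰S : S ∈ 𝒰 := le_principal_iff.1 (hle.trans inf_le_right)
  have h𝒰x : Tendsto Prod.fst (𝒰 : Filter (E × E)) (𝓝 x) :=
    tendsto_iff_comap.2 (hle.trans inf_le_left)
  have hb := hS.not_tendsto_norm_snd hV hVS hx 𝒰 h𝒰S h𝒰x
  simp only [tendsto_atTop, not_forall] at hb
  obtain ⟨R, hR⟩ := hb
  rw [← Ultrafilter.eventually_not] at hR
  obtain ⟨y, -, hy⟩ := (isCompact_closedBall (0 : E) R).ultrafilter_le_nhds (𝒰.map Prod.snd)
    (le_principal_iff.2 (Filter.mem_map.2 (by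
      filter_upwards [hR] with p hp
      simpa using (not_le.1 hp).le)))
  refine ⟨y, hcl.mem_of_tendsto (b := (𝒰 : Filter (E × E))) (f := id) ?_ h𝒰S⟩
  rw [nhds_prod_eq]
  exact h𝒰x.prodMk hy

/-- A point of `S` over the segment from `p.1` to `p'.1`, close to `p.1`, is comparable with both
`p` and `p'`. Both comparisons are in the direction `p'.1 - p.1`, so they add up. -/
theorem inner_sub_nonneg_of_common_subset {S T T' : Set (E × E)} (hT : IsCyclicallyMonotone T)
    (hT' : IsCyclicallyMonotone T') (hST : S ⊆ T) (hST' : S ⊆ T') {V : Set E} (hV : IsOpen V)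
    (hVS : ∀ x ∈ V, ∃ y, (x, y) ∈ S) {p p' : E × E} (hp : p ∈ T) (hpV : p.1 ∈ V)
    (hp' : p' ∈ T') : 0 ≤ inner ℝ (p'.1 - p.1) (p'.2 - p.2) := by
  have hc : Tendsto (fun t : ℝ => p.1 + t • (p'.1 - p.1)) (𝓝[>] 0) (𝓝 p.1) := by
    have : Continuous fun t : ℝ => p.1 + t • (p'.1 - p.1) := by fun_prop
    simpa using (this.tendsto 0).mono_left nhdsWithin_le_nhds
  have hlt : ∀ᶠ t : ℝ in 𝓝[>] 0, t < 1 :=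
    (tendsto_id.mono_left nhdsWithin_le_nhds).eventually_lt_const one_pos
  obtain ⟨t, htV, ht1, ht0⟩ := ((hc.eventually_mem (hV.mem_nhds hpV)).and
    (hlt.and eventually_mem_nhdsWithin)).exists
  obtain ⟨s, hs⟩ := hVS _ htV
  have h1 := hT.inner_sub_nonneg (hST hs) hp
  have h2 := hT'.inner_sub_nonneg hp' (hST' hs)
  have e : p'.1 - (p.1 + t • (p'.1 - p.1)) = (1 - t) • (p'.1 - p.1) := by module
  simp only [add_sub_cancel_left, real_inner_smul_left, e] at h1 h2
  have h1' := nonneg_of_mul_nonneg_right h1 ht0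
  have h2' := nonneg_of_mul_nonneg_right h2 (sub_pos.2 ht1)
  have : p'.2 - p.2 = (p'.2 - s) + (s - p.2) := by abel
  rw [this, inner_add_right]
  exact add_nonneg h2' h1'

end CyclicMonotone

/-! ### Lower limits of maximal cyclically monotone sets. -/

section GraphLimit

/-- The lower limit of a family of sets along a filter. -/
def lowerLimit {ι X : Type*} [TopologicalSpace X] (l : Filter ι) (T : ι → Set X) : Set X :=
  {z | ∀ G ∈ 𝓝 z, ∀ᶠ n in l, (T n ∩ G).Nonempty}

/-- Along an ultrafilter every selection from a compact set converges, so cluster points already lie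
in the lower limit. -/
theorem exists_mem_lowerLimit {ι X : Type*} [TopologicalSpace X] (𝒰 : Ultrafilter ι)
    {T : ι → Set X} {K : Set X} (hK : IsCompact K) {z : ι → X}
    (hz : ∀ᶠ n in (𝒰 : Filter ι), z n ∈ T n ∩ K) :
    ∃ x ∈ K, x ∈ lowerLimit 𝒰 T ∧ Tendsto z 𝒰 (𝓝 x) := by
  obtain ⟨x, hxK, hx⟩ := hK.ultrafilter_le_nhds (𝒰.map z)
    (le_principal_iff.2 (Filter.mem_map.2 (hz.mono fun n hn => hn.2)))
  have hx' : Tendsto z 𝒰 (𝓝 x) := hx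
  refine ⟨x, hxK, fun G hG => ?_, hx'⟩
  filter_upwards [hz, hx'.eventually_mem hG] with n h1 h2
  exact ⟨z n, h1.1, h2⟩

theorem isCyclicallyMonotone_lowerLimit {ι E : Type*} [NormedAddCommGroup E]
    [InnerProductSpace ℝ E] (l : Filter ι) [l.NeBot] {T : ι → Set (E × E)}
    (hT : ∀ n, IsCyclicallyMonotone (T n)) : IsCyclicallyMonotone (lowerLimit l T) := by
  intro n p hp
  by_contra hlt
  have hopen : IsOpen {q : Fin (n + 1) → E × E |
      ¬ ∑ i, inner ℝ (q i).1 (q (i + 1)).2 ≤ ∑ i, inner ℝ (q i).1 (q i).2} := by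
    simp only [not_le]
    exact isOpen_lt (by fun_prop) (by fun_prop)
  obtain ⟨G, hG, hsub⟩ : ∃ G : Fin (n + 1) → Set (E × E), (∀ i, G i ∈ 𝓝 (p i)) ∧
      Set.univ.pi G ⊆ {q : Fin (n + 1) → E × E |
        ¬ ∑ i, inner ℝ (q i).1 (q (i + 1)).2 ≤ ∑ i, inner ℝ (q i).1 (q i).2} := by
    have := hopen.mem_nhds hlt
    rw [nhds_pi, Filter.mem_pi'] at this
    obtain ⟨I, G, hG, hsub⟩ := this
    exact ⟨G, hG, (Set.pi_mono' (fun i _ => subset_rfl) (Set.subset_univ _)).trans hsub⟩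
  obtain ⟨k, hk⟩ := (eventually_all.2 fun i => hp i (G i) (hG i)).exists
  choose q hqT hqG using hk
  exact hsub (fun i _ => hqG i) (hT k n q hqT)

/-- The two graph inclusions behind the convergence of maximal cyclically monotone sets. -/
theorem lowerLimit_inter_eq {ι E : Type*} [NormedAddCommGroup E] [InnerProductSpace ℝ E]
    [FiniteDimensional ℝ E] (𝒰 : Ultrafilter ι) {Ts : ι → Set (E × E)}
    (hTs : ∀ n, Maximal IsCyclicallyMonotone (Ts n)) {T S : Set (E × E)}
    (hT : Maximal IsCyclicallyMonotone T) (hS : S ⊆ T) (hS' : S ⊆ lowerLimit 𝒰 Ts)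
    {V : Set E} (hV : IsOpen V) (hVS : ∀ x ∈ V, ∃ y, (x, y) ∈ S) {p : E × E}
    (hpV : p.1 ∈ V) : p ∈ lowerLimit 𝒰 Ts ↔ p ∈ T := by
  have hT' := isCyclicallyMonotone_lowerLimit (𝒰 : Filter ι) fun n => (hTs n).prop
  have huniq : ∀ q : E × E, q.1 + q.2 = p.1 + p.2 →
      0 ≤ inner ℝ (q.1 - p.1) (q.2 - p.2) → q = p := by
    intro q hq h
    have e : q.2 - p.2 = -(q.1 - p.1) := by
      rw [← sub_eq_zero]
      rw [← sub_eq_zero] at hq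
      rw [← hq]
      abel
    rw [e, inner_neg_right, real_inner_self_eq_norm_sq] at h
    have h0 : q.1 - p.1 = 0 := by
      rw [← norm_eq_zero]
      nlinarith [norm_nonneg (q.1 - p.1)]
    refine Prod.ext (sub_eq_zero.1 h0) ?_
    rwa [h0, neg_zero, sub_eq_zero] at e
  constructor
  · intro hp
    obtain ⟨q, hq, hadd⟩ := Maximal.exists_mem_add_eq hT (p.1 + p.2)
    have := inner_sub_nonneg_of_common_subset hT' hT.prop hS' hS hV hVS hp hpV hq
    rwa [← huniq q hadd this]
  · intro hp
    -- The points `q n` stay bounded: for `s` in `Ts n` near `c`, monotonicity bounds the squared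
    -- norms of both components of `q n - s` by that of their sum, which is controlled. Their limit
    -- has the coordinate sum of `p`, hence is `p`.
    choose q hq hadd using fun n => Maximal.exists_mem_add_eq (hTs n) (p.1 + p.2)
    obtain ⟨y, hy⟩ := hVS p.1 hpV
    set c : E × E := (p.1, y)
    have hc := hS' hy (Metric.ball c 1) (Metric.ball_mem_nhds c one_pos)
    set R : ℝ := ‖p.1 + p.2‖ + 2 * (‖c‖ + 1) with hR
    have hbound : ∀ᶠ n in (𝒰 : Filter ι), q n ∈ Ts n ∩ Metric.closedBall 0 (R + (‖c‖ + 1)) := by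
      filter_upwards [hc] with n hn
      obtain ⟨s, hsT, hsc⟩ := hn
      refine ⟨hq n, ?_⟩
      have hmon := (hTs n).prop.inner_sub_nonneg (hq n) hsT
      have hs : ‖s‖ ≤ ‖c‖ + 1 := by
        have h1 : ‖s - c‖ < 1 := by rwa [← dist_eq_norm]
        have h2 := norm_add_le c (s - c)
        rw [add_sub_cancel] at h2
        linarith
      have hs1 : ‖s.1‖ ≤ ‖c‖ + 1 := (norm_fst_le s).trans hs
      have hs2 : ‖s.2‖ ≤ ‖c‖ + 1 := (norm_snd_le s).trans hs
      have hsum : ‖((q n).1 - s.1) + ((q n).2 - s.2)‖ ≤ R := by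
        have e : ((q n).1 - s.1) + ((q n).2 - s.2) = (p.1 + p.2) - (s.1 + s.2) := by
          rw [← hadd n]
          abel
        rw [e]
        have h1 := norm_sub_le (p.1 + p.2) (s.1 + s.2)
        have h2 := norm_add_le s.1 s.2
        linarith
      have hsq := norm_add_sq_real ((q n).1 - s.1) ((q n).2 - s.2)
      have hR0 : 0 ≤ R := by positivity
      have hsq' := pow_le_pow_left₀ (norm_nonneg _) hsum 2
      have b1 : ‖(q n).1 - s.1‖ ≤ R :=
        abs_le_of_sq_le_sq' (by nlinarith [sq_nonneg ‖(q n).2 - s.2‖]) hR0 |>.2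
      have b2 : ‖(q n).2 - s.2‖ ≤ R :=
        abs_le_of_sq_le_sq' (by nlinarith [sq_nonneg ‖(q n).1 - s.1‖]) hR0 |>.2
      rw [mem_closedBall_zero_iff, Prod.norm_def]
      refine max_le ?_ ?_
      · have := norm_add_le ((q n).1 - s.1) s.1
        rw [sub_add_cancel] at this
        linarith
      · have := norm_add_le ((q n).2 - s.2) s.2
        rw [sub_add_cancel] at this
        linarith
    obtain ⟨x, -, hx, hlim⟩ := exists_mem_lowerLimit 𝒰 (isCompact_closedBall _ _) hbound
    have hxadd : x.1 + x.2 = p.1 + p.2 := by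
      have h1 : Tendsto (fun n => (q n).1 + (q n).2) 𝒰 (𝓝 (x.1 + x.2)) :=
        ((continuous_fst.add continuous_snd).tendsto x).comp hlim
      simp only [hadd] at h1
      exact tendsto_nhds_unique h1 tendsto_const_nhds
    have := inner_sub_nonneg_of_common_subset hT.prop hT' hS hS' hV hVS hp hpV hx
    rwa [← huniq x hxadd this]

end GraphLimit

end ZeroCoupling

/-! ### Test functions, cutoffs and mass away from the origin. -/

namespace ZeroCoupling

theorem M0.tendsto_iff_forall_integral {ι F : Type*} [Zero F] [TopologicalSpace F]
    [MeasurableSpace F] {l : Filter ι} {μs : ι → M0 F} {μ : M0 F} :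
    Tendsto μs l (𝓝 μ) ↔ ∀ f ∈ testFunctions F,
      Tendsto (fun n => ∫ x, f x ∂(μs n).toMeasure) l (𝓝 (∫ x, f x ∂μ.toMeasure)) := by
  rw [M0.instTopologicalSpace, nhds_iInf, tendsto_iInf]
  simp only [nhds_induced, tendsto_comap_iff, Subtype.forall, Function.comp_def]

section Measures

variable {F : Type*} [NormedAddCommGroup F]

/-- The part of the punctured space at distance at least `r` from the origin. -/
def away (F : Type*) [NormedAddCommGroup F] (r : ℝ) : Set (Punctured F) := {x | r ≤ ‖x.1‖}

theorem isClosed_away (r : ℝ) : IsClosed (away F r) :=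
  isClosed_le continuous_const (continuous_norm.comp continuous_subtype_val)

/-- A continuous function on the punctured space with values in `[0, 1]` which vanishes for
`‖x‖ ≤ r` and equals `1` for `2 * r ≤ ‖x‖`. -/
noncomputable def cutoff (F : Type*) [NormedAddCommGroup F] (r : ℝ) :
    BoundedContinuousFunction (Punctured F) ℝ :=
  BoundedContinuousFunction.ofNormedAddCommGroup
    (fun x => max 0 (min 1 (‖x.1‖ / r - 1)))
    (by fun_prop) 1 (fun x => by
      rw [Real.norm_eq_abs, abs_of_nonneg (le_max_left _ _)]
      exact max_le zero_le_one (min_le_left _ _))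

theorem cutoff_apply (r : ℝ) (x : Punctured F) :
    cutoff F r x = max 0 (min 1 (‖x.1‖ / r - 1)) := rfl

theorem cutoff_nonneg (r : ℝ) (x : Punctured F) : 0 ≤ cutoff F r x := le_max_left _ _

theorem cutoff_le_one (r : ℝ) (x : Punctured F) : cutoff F r x ≤ 1 :=
  max_le zero_le_one (min_le_left _ _)

theorem cutoff_eq_zero {r : ℝ} (hr : 0 < r) {x : Punctured F} (hx : ‖x.1‖ ≤ r) :
    cutoff F r x = 0 := by
  rw [cutoff_apply]
  exact max_eq_left ((min_le_right _ _).trans (by linarith [(div_le_one hr).2 hx]))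

theorem cutoff_eq_one {r : ℝ} (hr : 0 < r) {x : Punctured F} (hx : 2 * r ≤ ‖x.1‖) :
    cutoff F r x = 1 := by
  rw [cutoff_apply, min_eq_left (by linarith [(le_div_iff₀ hr).2 hx])]
  exact max_eq_right zero_le_one

theorem cutoff_pos {r : ℝ} (hr : 0 < r) {x : Punctured F} (hx : r < ‖x.1‖) :
    0 < cutoff F r x := by
  rw [cutoff_apply]
  exact lt_max_of_lt_right (lt_min one_pos (by linarith [(one_lt_div hr).2 hx]))

theorem mem_testFunctions_iff {f : BoundedContinuousFunction (Punctured F) ℝ} :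
    f ∈ testFunctions F ↔ ∃ r > 0, ∀ x : Punctured F, ‖x.1‖ < r → f x = 0 := by
  constructor
  · rintro ⟨U, hU, h⟩
    obtain ⟨r, hr, hsub⟩ := Metric.mem_nhds_iff.1 hU
    exact ⟨r, hr, fun x hx => h x (hsub (by simpa using hx))⟩
  · rintro ⟨r, hr, h⟩
    exact ⟨_, Metric.ball_mem_nhds 0 hr, fun x hx => h x (by simpa using hx)⟩

theorem cutoff_mem_testFunctions {r : ℝ} (hr : 0 < r) : cutoff F r ∈ testFunctions F :=
  mem_testFunctions_iff.2 ⟨r, hr, fun _ hx => cutoff_eq_zero hr hx.le⟩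

theorem mul_mem_testFunctions (f : BoundedContinuousFunction (Punctured F) ℝ)
    {g : BoundedContinuousFunction (Punctured F) ℝ} (hg : g ∈ testFunctions F) :
    f * g ∈ testFunctions F := by
  obtain ⟨U, hU, h⟩ := hg
  exact ⟨U, hU, fun x hx => by simp [h x hx]⟩

open CompactlySupported

/-- A compact subset of the punctured space remains compact in `F` and so keeps a positive distance
from the origin. -/
theorem exists_testFunction_eq (f : C_c(Punctured F, ℝ)) :
    ∃ g ∈ testFunctions F, ∀ x, g x = f x := by
  obtain ⟨C, hC⟩ := f.hasCompactSupport.exists_bound_of_continuous f.continuous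
  refine ⟨BoundedContinuousFunction.ofNormedAddCommGroup f f.continuous C hC, ?_, fun x => rfl⟩
  have hK : IsCompact (Subtype.val '' tsupport f : Set F) :=
    f.hasCompactSupport.isCompact.image continuous_subtype_val
  refine ⟨(Subtype.val '' tsupport f)ᶜ, hK.isClosed.isOpen_compl.mem_nhds ?_, fun x hx => ?_⟩
  · rintro ⟨y, -, hy⟩
    exact y.2 hy
  · exact image_eq_zero_of_notMem_tsupport fun h => hx ⟨x, h, rfl⟩

theorem away_anti {r R : ℝ} (h : r ≤ R) : away F R ⊆ away F r := fun _ hx => h.trans hx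

variable [MeasurableSpace F]

theorem finite_away_of_measure_away {m : Measure (Punctured F)}
    (h : ∀ r > 0, m (away F r) < ⊤) (B : Set F) (hB : (0 : F) ∉ closure B) :
    m (Subtype.val ⁻¹' B) < ⊤ := by
  obtain ⟨r, hr, hsub⟩ := Metric.isOpen_iff.1 (isClosed_closure (s := B)).isOpen_compl 0 hB
  refine (measure_mono fun x hx => ?_).trans_lt (h r hr)
  by_contra hlt
  exact hsub (a := x.1) (by simpa [away] using hlt) (subset_closure hx)

variable [BorelSpace F]

theorem measurableSet_away (r : ℝ) : MeasurableSet (away F r) := (isClosed_away r).measurableSet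

theorem M0.measure_away_lt_top (μ : M0 F) {r : ℝ} (hr : 0 < r) : μ.toMeasure (away F r) < ⊤ := by
  have hc : IsClosed {x : F | r ≤ ‖x‖} := isClosed_le continuous_const continuous_norm
  exact μ.finite_away {x | r ≤ ‖x‖} hc.measurableSet (by
    rw [hc.closure_eq]
    simpa using hr)

theorem integrable_of_vanish_near {m : Measure (Punctured F)} {r : ℝ} (hm : m (away F r) < ⊤)
    (f : BoundedContinuousFunction (Punctured F) ℝ)
    (hf : ∀ x : Punctured F, ‖x.1‖ < r → f x = 0) : Integrable f m := by
  rw [← integrableOn_iff_integrable_of_support_subset (s := away F r)]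
  · have : IsFiniteMeasure (m.restrict (away F r)) := ⟨by simpa using hm⟩
    exact f.integrable _
  · intro x hx
    by_contra hlt
    exact hx (hf x (by simpa [away] using hlt))

theorem M0.integrable (μ : M0 F) {f : BoundedContinuousFunction (Punctured F) ℝ}
    (hf : f ∈ testFunctions F) : Integrable f μ.toMeasure := by
  obtain ⟨r, hr, h⟩ := mem_testFunctions_iff.1 hf
  exact integrable_of_vanish_near (μ.measure_away_lt_top hr) f h

theorem M0.abs_integral_le (μ : M0 F) {f : Punctured F → ℝ} {r C : ℝ} (hr : 0 < r)
    (hC : ∀ x, |f x| ≤ C) (hf : ∀ x : Punctured F, ‖x.1‖ < r → f x = 0) :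
    |∫ x, f x ∂μ.toMeasure| ≤ C * μ.toMeasure.real (away F r) := by
  rw [← setIntegral_eq_integral_of_forall_compl_eq_zero (s := away F r)]
  · exact norm_setIntegral_le_of_norm_le_const (μ.measure_away_lt_top hr) fun x _ =>
      (Real.norm_eq_abs (f x)).trans_le (hC x)
  · intro x hx
    exact hf x (by simpa [away] using hx)

theorem M0.real_away_le_integral_cutoff (μ : M0 F) {r : ℝ} (hr : 0 < r) :
    μ.toMeasure.real (away F (2 * r)) ≤ ∫ x, cutoff F r x ∂μ.toMeasure := by
  rw [← integral_indicator_one (measurableSet_away _)]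
  refine integral_mono_of_nonneg
    (ae_of_all _ fun x => Set.indicator_nonneg (fun _ _ => zero_le_one) x)
    (μ.integrable (cutoff_mem_testFunctions hr)) (ae_of_all _ fun x => ?_)
  by_cases hx : x ∈ away F (2 * r)
  · rw [Set.indicator_of_mem hx, cutoff_eq_one hr hx]
    rfl
  · rw [Set.indicator_of_notMem hx]
    exact cutoff_nonneg r x

theorem M0.integral_cutoff_le (μ : M0 F) {r : ℝ} (hr : 0 < r) :
    ∫ x, cutoff F r x ∂μ.toMeasure ≤ μ.toMeasure.real (away F r) := by
  have := μ.abs_integral_le (f := cutoff F r) (C := 1) hr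
    (fun x => by rw [abs_of_nonneg (cutoff_nonneg r x)]; exact cutoff_le_one r x)
    (fun x hx => cutoff_eq_zero hr hx.le)
  rw [one_mul] at this
  exact (le_abs_self _).trans this

/-- The integral of `cutoff F r` lies between the masses of `away F (2 * r)` and `away F r`, whence
the doubled radius. -/
theorem M0.eventually_real_away_le {ι : Type*} {l : Filter ι} {μs : ι → M0 F} {μ : M0 F}
    (h : Tendsto μs l (𝓝 μ)) {r c : ℝ} (hr : 0 < r) (hc : μ.toMeasure.real (away F r) < c) :
    ∀ᶠ n in l, (μs n).toMeasure.real (away F (2 * r)) ≤ c := by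
  have := M0.tendsto_iff_forall_integral.1 h _ (cutoff_mem_testFunctions hr)
  filter_upwards [this.eventually_lt_const ((μ.integral_cutoff_le hr).trans_lt hc)] with n hn
  exact ((μs n).real_away_le_integral_cutoff hr).trans hn.le

theorem M0.exists_real_away_lt (μ : M0 F) {ε : ℝ} (hε : 0 < ε) :
    ∃ R > 0, μ.toMeasure.real (away F R) < ε := by
  -- The shift by `1` keeps the first radius positive, hence the first mass finite.
  have hanti : Antitone fun k : ℕ => away F (k + 1) := fun i j hij =>
    away_anti (add_le_add_left (Nat.cast_le.2 hij) 1)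
  have hinter : ⋂ k : ℕ, away F (k + 1) = ∅ := by
    rw [Set.eq_empty_iff_forall_notMem]
    intro x hx
    obtain ⟨k, hk⟩ := exists_nat_gt ‖x.1‖
    have : (k : ℝ) + 1 ≤ ‖x.1‖ := Set.mem_iInter.1 hx k
    linarith
  have ht := tendsto_measure_iInter_atTop (μ := μ.toMeasure)
    (fun k : ℕ => (measurableSet_away (F := F) (k + 1)).nullMeasurableSet) hanti
    ⟨0, (μ.measure_away_lt_top (by positivity)).ne⟩
  rw [hinter, measure_empty] at ht
  have ht' := (ENNReal.tendsto_toReal ENNReal.zero_ne_top).comp ht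
  obtain ⟨k, hk⟩ := (ht'.eventually_lt_const (by simpa using hε)).exists
  exact ⟨k + 1, by positivity, hk⟩

end Measures

/-! ### Compactness in `M₀` and supports of limits. -/

section Compactness

variable {F : Type*} [NormedAddCommGroup F] [ProperSpace F]

instance : LocallyCompactSpace (Punctured F) :=
  (isOpen_ne : IsOpen {x : F | x ≠ 0}).locallyCompactSpace

theorem isCompact_annulus {r : ℝ} (hr : 0 < r) (R : ℝ) :
    IsCompact {x : Punctured F | r ≤ ‖x.1‖ ∧ ‖x.1‖ ≤ R} := by
  rw [Subtype.isCompact_iff]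
  refine (isCompact_closedBall (0 : F) R).of_isClosed_subset ?_ ?_
  · have : Subtype.val '' {x : Punctured F | r ≤ ‖x.1‖ ∧ ‖x.1‖ ≤ R} =
        {x : F | r ≤ ‖x‖} ∩ {x | ‖x‖ ≤ R} := by
      ext x
      constructor
      · rintro ⟨y, hy, rfl⟩
        exact hy
      · intro hx
        exact ⟨⟨x, norm_pos_iff.1 (hr.trans_le hx.1)⟩, hx, rfl⟩
    rw [this]
    exact (isClosed_le continuous_const continuous_norm).inter
      (isClosed_le continuous_norm continuous_const)
  · rintro _ ⟨y, hy, rfl⟩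
    simpa using hy.2

open CompactlySupported

/-- A bounded continuous function restricted by a cutoff to an annulus. -/
noncomputable def truncate (f : BoundedContinuousFunction (Punctured F) ℝ)
    (hf : f ∈ testFunctions F) {R : ℝ} (hR : 0 < R) : C_c(Punctured F, ℝ) :=
  ⟨(f * (1 - cutoff F R) : BoundedContinuousFunction (Punctured F) ℝ).toContinuousMap, by
    obtain ⟨r, hr, h⟩ := mem_testFunctions_iff.1 hf
    refine HasCompactSupport.intro (isCompact_annulus hr (2 * R)) fun x hx => ?_
    rw [Set.mem_ofPred_eq, not_and_or, not_le, not_le] at hx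
    rcases hx with hx | hx
    · simp [h x hx]
    · simp [cutoff_eq_one hR hx.le]⟩

theorem truncate_apply (f : BoundedContinuousFunction (Punctured F) ℝ)
    (hf : f ∈ testFunctions F) {R : ℝ} (hR : 0 < R) (x : Punctured F) :
    truncate f hf hR x = f x * (1 - cutoff F R x) := rfl

variable [MeasurableSpace F] [BorelSpace F]

theorem regular_of_measure_away {m : Measure (Punctured F)} (h : ∀ r > 0, m (away F r) < ⊤) :
    m.Regular := by
  have : IsLocallyFiniteMeasure m := by
    refine ⟨fun x => ?_⟩
    have hx : 0 < ‖x.1‖ := norm_pos_iff.2 x.2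
    refine ⟨away F (‖x.1‖ / 2), ?_, h _ (by positivity)⟩
    have hc : Continuous fun y : Punctured F => ‖y.1‖ := by fun_prop
    filter_upwards [hc.continuousAt.eventually_const_lt (half_lt_self hx)] with y hy
    exact hy.le
  infer_instance

/-- Relative compactness in `M₀(F)` along an ultrafilter. -/
theorem M0.exists_tendsto_of_tight {ι : Type*} (𝒰 : Ultrafilter ι) (γs : ι → M0 F)
    (hbdd : ∀ r > 0, ∃ M, ∀ᶠ n in (𝒰 : Filter ι), (γs n).toMeasure.real (away F r) ≤ M)
    (htight : ∀ ε > 0, ∃ R > 0, ∀ᶠ n in (𝒰 : Filter ι),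
      (γs n).toMeasure.real (away F R) ≤ ε) :
    ∃ γ : M0 F, Tendsto γs 𝒰 (𝓝 γ) := by
  have hlim : ∀ f : C_c(Punctured F, ℝ), ∃ a : ℝ,
      Tendsto (fun n => ∫ x, f x ∂(γs n).toMeasure) 𝒰 (𝓝 a) := by
    intro f
    obtain ⟨g, hg, hgf⟩ := exists_testFunction_eq f
    obtain ⟨r, hr, h⟩ := mem_testFunctions_iff.1 hg
    obtain ⟨M, hM⟩ := hbdd r hr
    obtain ⟨a, -, ha⟩ := (isCompact_Icc (a := -(‖g‖ * M)) (b := ‖g‖ * M)).ultrafilter_le_nhds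
      (𝒰.map fun n => ∫ x, f x ∂(γs n).toMeasure) (le_principal_iff.2 (Filter.mem_map.2 (by
        filter_upwards [hM] with n hn
        rw [Set.mem_preimage, Set.mem_Icc, ← abs_le]
        simp only [← hgf]
        exact ((γs n).abs_integral_le hr g.norm_coe_le_norm h).trans
          (mul_le_mul_of_nonneg_left hn (norm_nonneg g)))))
    exact ⟨a, ha⟩
  choose L hL using hlim
  have hint : ∀ (f : C_c(Punctured F, ℝ)) n, Integrable f (γs n).toMeasure := by
    intro f n
    obtain ⟨g, hg, hgf⟩ := exists_testFunction_eq f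
    exact ((γs n).integrable hg).congr (ae_of_all _ hgf)
  let Λ : C_c(Punctured F, ℝ) →ₚ[ℝ] ℝ := PositiveLinearMap.mk₀
    { toFun := L
      map_add' := fun f g => by
        refine tendsto_nhds_unique (hL (f + g)) (((hL f).add (hL g)).congr fun n => ?_)
        exact (integral_add (hint f n) (hint g n)).symm
      map_smul' := fun c f => by
        refine tendsto_nhds_unique (hL (c • f)) (((hL f).const_mul c).congr fun n => ?_)
        exact (integral_const_mul c _).symm }
    fun f hf => ge_of_tendsto' (hL f) fun n => integral_nonneg hf
  have hΛ : ∀ f, Λ f = L f := fun _ => rfl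
  -- The ultrafilter limits on compactly supported functions form a positive functional; its Riesz
  -- measure is the candidate limit.
  set m := RealRMK.rieszMeasure Λ with hm
  have hmass : ∀ r > 0, ∀ M, (∀ᶠ n in (𝒰 : Filter ι), (γs n).toMeasure.real (away F r) ≤ M) →
      m (away F (2 * r)) ≤ ENNReal.ofReal M := by
    intro r hr M hM
    have hun : away F (2 * r) = ⋃ k : ℕ, {x : Punctured F | 2 * r ≤ ‖x.1‖ ∧ ‖x.1‖ ≤ k} := by
      ext x
      obtain ⟨k, hk⟩ := exists_nat_gt ‖x.1‖
      simp only [away, Set.mem_ofPred_eq, Set.mem_iUnion]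
      exact ⟨fun h => ⟨k, h, hk.le⟩, fun ⟨_, h, _⟩ => h⟩
    have hmono : Monotone fun k : ℕ => {x : Punctured F | 2 * r ≤ ‖x.1‖ ∧ ‖x.1‖ ≤ k} :=
      fun i j hij x hx => ⟨hx.1, hx.2.trans (by exact_mod_cast hij)⟩
    rw [hun, hmono.measure_iUnion]
    refine iSup_le fun k => ?_
    -- Truncating at `k + 1` gives a positive radius even for `k = 0`, and leaves the function equal
    -- to `1` on the annulus.
    have hk : (0 : ℝ) < k + 1 := by positivity
    set f := truncate (cutoff F r) (cutoff_mem_testFunctions hr) hk with hf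
    have hf0 : ∀ x, 0 ≤ f x := fun x => by
      rw [hf, truncate_apply]
      exact mul_nonneg (cutoff_nonneg _ _) (sub_nonneg.2 (cutoff_le_one _ _))
    refine (RealRMK.rieszMeasure_le_of_eq_one Λ hf0 (isCompact_annulus (by positivity) k)
      fun x hx => ?_).trans (ENNReal.ofReal_le_ofReal ?_)
    · rw [hf, truncate_apply, cutoff_eq_one hr hx.1, cutoff_eq_zero hk (by linarith [hx.2])]
      norm_num
    · rw [hΛ]
      refine le_of_tendsto (hL f) ?_
      filter_upwards [hM] with n hn
      have := (γs n).abs_integral_le (f := f) (C := 1) hr (fun x => by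
        rw [abs_of_nonneg (hf0 x), hf, truncate_apply]
        exact mul_le_one₀ (cutoff_le_one _ _) (sub_nonneg.2 (cutoff_le_one _ _))
          (by linarith [cutoff_nonneg (F := F) (k + 1) x])) (fun x hx => by
        rw [hf, truncate_apply, cutoff_eq_zero hr hx.le, zero_mul])
      rw [one_mul] at this
      exact (le_abs_self _).trans (this.trans hn)
  have hfin : ∀ r > 0, m (away F r) < ⊤ := by
    intro r hr
    obtain ⟨M, hM⟩ := hbdd (r / 2) (half_pos hr)
    have := hmass _ (half_pos hr) M hM
    rw [mul_div_cancel₀ r two_ne_zero] at this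
    exact this.trans_lt ENNReal.ofReal_lt_top
  let γ : M0 F := ⟨m, fun B _ hB => finite_away_of_measure_away hfin B hB⟩
  refine ⟨γ, M0.tendsto_iff_forall_integral.2 fun f hf => ?_⟩
  have herr : ∀ (σ : M0 F) (R : ℝ) (hR : 0 < R),
      |∫ x, f x ∂σ.toMeasure - ∫ x, truncate f hf hR x ∂σ.toMeasure| ≤
        ‖f‖ * σ.toMeasure.real (away F R) := by
    intro σ R hR
    obtain ⟨g, hg, hgf⟩ := exists_testFunction_eq (truncate f hf hR)
    rw [← integral_sub (σ.integrable hf) ((σ.integrable hg).congr (ae_of_all _ hgf))]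
    have e : ∀ x, f x - truncate f hf hR x = f x * cutoff F R x := fun x => by
      rw [truncate_apply]
      ring
    simp only [e]
    refine σ.abs_integral_le hR (fun x => ?_) fun x hx => by
      rw [cutoff_eq_zero hR hx.le, mul_zero]
    rw [abs_mul, abs_of_nonneg (cutoff_nonneg R x)]
    exact (mul_le_of_le_one_right (abs_nonneg _) (cutoff_le_one R x)).trans
      (f.norm_coe_le_norm x)
  rw [Metric.tendsto_nhds]
  intro ε hε
  -- One third of `ε` goes to each of the two tails and one to the truncated integrals; `‖f‖ + 1`
  -- covers `f = 0`.
  set δ : ℝ := ε / (3 * (‖f‖ + 1)) with hδ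
  have hδ0 : 0 < δ := by positivity
  have hfδ : ‖f‖ * δ < ε / 3 := by
    have : (‖f‖ + 1) * δ = ε / 3 := by
      rw [hδ]
      field_simp
    linarith
  obtain ⟨R, hR, htR⟩ := htight δ hδ0
  have h2R : 0 < 2 * R := by positivity
  have hγR : m.real (away F (2 * R)) ≤ δ :=
    ENNReal.toReal_le_of_le_ofReal hδ0.le (hmass R hR δ htR)
  have hγf : ∫ x, truncate f hf h2R x ∂m = L (truncate f hf h2R) :=
    (RealRMK.integral_rieszMeasure Λ _).trans (hΛ _)
  have hconv := Metric.tendsto_nhds.1 (hL (truncate f hf h2R)) (ε / 3) (by positivity)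
  filter_upwards [htR, hconv] with n h1 h2
  have e1 := herr (γs n) (2 * R) h2R
  have e2 := herr γ (2 * R) h2R
  have h1' : (γs n).toMeasure.real (away F (2 * R)) ≤ δ :=
    (measureReal_mono (away_anti (by linarith))
      ((γs n).measure_away_lt_top hR).ne).trans h1
  have e1' := e1.trans (mul_le_mul_of_nonneg_left h1' (norm_nonneg f))
  have e2' := e2.trans (mul_le_mul_of_nonneg_left hγR (norm_nonneg f))
  change |∫ x, f x ∂m - ∫ x, truncate f hf h2R x ∂m| ≤ _ at e2'
  change |∫ x, f x ∂(γs n).toMeasure - ∫ x, f x ∂m| < ε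
  rw [Real.dist_eq, ← hγf] at h2
  rw [abs_le] at e1' e2'
  rw [abs_lt] at h2 ⊢
  constructor <;> linarith [e1'.1, e1'.2, e2'.1, e2'.2, h2.1, h2.2]

/-- The support of a limit in `M₀(F)` lies in the lower limit of the supports. -/
theorem M0.supp_subset_lowerLimit {ι : Type*} {l : Filter ι} {γs : ι → M0 F} {γ : M0 F}
    (h : Tendsto γs l (𝓝 γ)) : γ.supp ⊆ lowerLimit l fun n => (γs n).supp := by
  intro z hz G hG
  obtain ⟨ρ, hρ, hsub⟩ := Metric.mem_nhds_iff.1 hG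
  have hpos := (Measure.mem_support_iff_forall z).1 hz _ (Metric.ball_mem_nhds z hρ)
  rw [extend, Measure.map_apply measurable_subtype_coe Metric.isOpen_ball.measurableSet] at hpos
  let b : BoundedContinuousFunction (Punctured F) ℝ :=
    BoundedContinuousFunction.ofNormedAddCommGroup (fun x => max 0 (ρ - dist x.1 z))
      (by fun_prop) ρ (fun x => by
        rw [Real.norm_eq_abs, abs_of_nonneg (le_max_left _ _)]
        exact max_le hρ.le (sub_le_self _ dist_nonneg))
  have hb : ∀ x, b x = max 0 (ρ - dist x.1 z) := fun _ => rfl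
  -- As `z` may be the origin, the bump `b` need not be a test function; shrinking cutoffs exhaust
  -- the punctured ball.
  have hun : (Subtype.val ⁻¹' Metric.ball z ρ : Set (Punctured F)) ⊆
      ⋃ k : ℕ, Function.support (b * cutoff F (1 / (k + 1) : ℝ)) := by
    intro x hx
    obtain ⟨k, hk⟩ := exists_nat_one_div_lt (norm_pos_iff.2 x.2)
    refine Set.mem_iUnion.2 ⟨k, mul_ne_zero ?_ (cutoff_pos (by positivity) hk).ne'⟩
    rw [hb]
    exact (lt_max_of_lt_right (sub_pos.2 hx)).ne'
  obtain ⟨k, hk⟩ : ∃ k : ℕ,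
      0 < γ.toMeasure (Function.support (b * cutoff F (1 / (k + 1) : ℝ))) := by
    by_contra! hall
    exact hpos.ne' (measure_mono_null hun (measure_iUnion_null fun k => le_zero_iff.1 (hall k)))
  set r : ℝ := 1 / (k + 1)
  have hr : 0 < r := by positivity
  have htest := mul_mem_testFunctions b (cutoff_mem_testFunctions (F := F) hr)
  have hnn : ∀ x, 0 ≤ (b * cutoff F r) x :=
    fun x => mul_nonneg (le_max_left _ _) (cutoff_nonneg r x)
  have hint : 0 < ∫ x, (b * cutoff F r) x ∂γ.toMeasure :=
    (integral_pos_iff_support_of_nonneg hnn (γ.integrable htest)).2 hk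
  filter_upwards [(M0.tendsto_iff_forall_integral.1 h _ htest).eventually_const_lt hint] with n hn
  have hn' := (integral_pos_iff_support_of_nonneg hnn ((γs n).integrable htest)).1 hn
  have hG' : 0 < extend (γs n).toMeasure (Metric.ball z ρ) := by
    rw [extend, Measure.map_apply measurable_subtype_coe Metric.isOpen_ball.measurableSet]
    refine hn'.trans_le (measure_mono fun x hx => ?_)
    by_contra hx'
    refine hx ?_
    have : b x = 0 := by
      rw [hb]
      exact max_eq_left (sub_nonpos.2 (not_lt.1 hx'))
    simp [this]
  obtain ⟨x, hx, hxs⟩ := Measure.nonempty_inter_support_of_pos hG'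
  exact ⟨x, hxs, hsub hx⟩

end Compactness

end ZeroCoupling

/-! ### Stability and compactness of zero-couplings. -/

namespace ZeroCoupling

section Couplings

variable {E : Type*} [NormedAddCommGroup E]

/-- The extension of a function on the punctured space by zero at the origin. -/
noncomputable def extendZero (f : Punctured E → ℝ) : E → ℝ := Function.extend Subtype.val f 0

theorem extendZero_coe (f : Punctured E → ℝ) (x : Punctured E) : extendZero f x.1 = f x :=
  Subtype.val_injective.extend_apply f 0 x

theorem extendZero_zero (f : Punctured E → ℝ) : extendZero f 0 = 0 :=
  Function.extend_apply' _ _ _ fun ⟨x, hx⟩ => x.2 hx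

theorem continuous_extendZero {f : BoundedContinuousFunction (Punctured E) ℝ}
    (hf : f ∈ testFunctions E) : Continuous (extendZero f) := by
  refine continuous_iff_continuousAt.2 fun x => ?_
  by_cases hx : x = 0
  · obtain ⟨U, hU, h⟩ := hf
    subst hx
    refine (continuousAt_const (y := (0 : ℝ))).congr ?_
    filter_upwards [hU] with y hy
    by_cases hy0 : y = 0
    · rw [hy0, extendZero_zero]
    · exact ((extendZero_coe f ⟨y, hy0⟩).trans (h ⟨y, hy0⟩ hy)).symm
  · have ho : IsOpenEmbedding (Subtype.val : Punctured E → E) :=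
      (isOpen_ne : IsOpen {x : E | x ≠ 0}).isOpenEmbedding_subtypeVal
    have : ContinuousAt (extendZero f ∘ Subtype.val) (⟨x, hx⟩ : Punctured E) := by
      have e : extendZero f ∘ Subtype.val = f := funext fun y => extendZero_coe f y
      rw [e]
      exact f.continuous.continuousAt
    exact ho.continuousAt_iff.1 this

/-- The pull-back of a test function along a continuous map fixing the origin. -/
theorem exists_pullback_testFunction {F : Type*} [NormedAddCommGroup F] {π : F → E}
    (hπ : Continuous π) (h0 : π 0 = 0) {f : BoundedContinuousFunction (Punctured E) ℝ}
    (hf : f ∈ testFunctions E) : ∃ g ∈ testFunctions F, ∀ x, g x = extendZero f (π x.1) := by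
  refine ⟨BoundedContinuousFunction.ofNormedAddCommGroup (fun x => extendZero f (π x.1))
    ((continuous_extendZero hf).comp (hπ.comp continuous_subtype_val)) ‖f‖ fun x => ?_,
    ?_, fun x => rfl⟩
  · by_cases hx : π x.1 = 0
    · rw [hx, extendZero_zero, norm_zero]
      exact norm_nonneg f
    · rw [show extendZero f (π x.1) = f ⟨π x.1, hx⟩ from extendZero_coe f ⟨π x.1, hx⟩]
      exact f.norm_coe_le_norm _
  · obtain ⟨U, hU, h⟩ := hf
    refine ⟨π ⁻¹' U, hπ.continuousAt.preimage_mem_nhds (by rwa [h0]), fun x hx => ?_⟩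
    change extendZero f (π x.1) = 0
    by_cases hx0 : π x.1 = 0
    · rw [hx0, extendZero_zero]
    · exact (extendZero_coe f ⟨π x.1, hx0⟩).trans (h ⟨π x.1, hx0⟩ hx)

variable [MeasurableSpace E] [BorelSpace E]

/-- The mass that `π` sends to the origin is discarded by `res` and unseen by `extendZero f`. -/
theorem integral_res_map {F : Type*} [NormedAddCommGroup F] [MeasurableSpace F] [BorelSpace F]
    (m : Measure (Punctured F)) {π : F → E} (hπ : Measurable π)
    {f : BoundedContinuousFunction (Punctured E) ℝ} (hf : f ∈ testFunctions E) :
    ∫ x, f x ∂res ((extend m).map π) = ∫ x, extendZero f (π x.1) ∂m := by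
  have h0 : MeasurableSet {x : E | x ≠ 0} := (measurableSet_singleton (0 : E)).compl
  have hm := (continuous_extendZero hf).measurable
  calc ∫ x, f x ∂res ((extend m).map π)
      = ∫ x : Punctured E, extendZero f x.1 ∂res ((extend m).map π) := by
        simp only [extendZero_coe]
    _ = ∫ x in {x : E | x ≠ 0}, extendZero f x ∂((extend m).map π) :=
        integral_subtype_comap h0 _
    _ = ∫ x, extendZero f x ∂((extend m).map π) :=
        setIntegral_eq_integral_of_forall_compl_eq_zero fun x hx => by
          rw [show x = 0 from not_not.1 hx, extendZero_zero]
    _ = ∫ z, extendZero f (π z) ∂(extend m) :=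
        integral_map_of_stronglyMeasurable hπ hm.stronglyMeasurable
    _ = ∫ x, extendZero f (π x.1) ∂m :=
        integral_map_of_stronglyMeasurable measurable_subtype_coe
          (hm.comp hπ).stronglyMeasurable

theorem res_map_apply {F : Type*} [NormedAddCommGroup F] [MeasurableSpace F] [BorelSpace F]
    (m : Measure (Punctured F)) {π : F → E} (hπ : Measurable π) {A : Set E}
    (hA : MeasurableSet A) :
    res ((extend m).map π) (Subtype.val ⁻¹' A) =
      m {x | π x.1 ∈ A ∧ π x.1 ≠ 0} := by
  have hm : MeasurableSet {x : E | x ≠ 0} := (measurableSet_singleton (0 : E)).compl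
  rw [res, show ∀ m' : Measure E, m'.comap (Subtype.val : Punctured E → E) (Subtype.val ⁻¹' A) =
      m' (Subtype.val '' (Subtype.val ⁻¹' A)) from
    fun m' => (MeasurableEmbedding.subtype_coe hm).comap_apply m' _, extend, Subtype.image_preimage_coe, Measure.map_apply hπ (hm.inter hA),
    Measure.map_apply measurable_subtype_coe (hπ (hm.inter hA))]
  congr 1
  ext x
  exact and_comm

/-- Test functions pull back to test functions because `π` is continuous and fixes the origin. The
bound `hle` keeps the limiting marginal finite away from the origin, hence regular and determined by
compactly supported functions. -/
theorem M0.eq_res_map_of_tendsto [ProperSpace E] {F : Type*} [NormedAddCommGroup F]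
    [MeasurableSpace F] [BorelSpace F] {ι : Type*} {l : Filter ι} [l.NeBot] {μs : ι → M0 E}
    {μ : M0 E} {γs : ι → M0 F} {γ : M0 F} (hμ : Tendsto μs l (𝓝 μ)) (hγ : Tendsto γs l (𝓝 γ))
    {π : F → E} (hπ : Continuous π) (h0 : π 0 = 0) (hle : ∀ x, ‖π x‖ ≤ ‖x‖)
    (h : ∀ n, res ((extend (γs n).toMeasure).map π) = (μs n).toMeasure) :
    res ((extend γ.toMeasure).map π) = μ.toMeasure := by
  have hfin : ∀ r > 0, res ((extend γ.toMeasure).map π) (away E r) < ⊤ := by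
    intro r hr
    have hA : MeasurableSet {x : E | r ≤ ‖x‖} := measurableSet_le measurable_const measurable_norm
    refine (res_map_apply γ.toMeasure hπ.measurable hA).trans_lt ?_
    exact (measure_mono fun x hx => hx.1.trans (hle x.1)).trans_lt (γ.measure_away_lt_top hr)
  have := regular_of_measure_away hfin
  have := regular_of_measure_away fun r hr => μ.measure_away_lt_top (r := r) hr
  refine Measure.ext_of_integral_eq_on_compactlySupported fun f => ?_
  obtain ⟨g, hg, hgf⟩ := exists_testFunction_eq f
  obtain ⟨k, hk, hkg⟩ := exists_pullback_testFunction hπ h0 hg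
  simp only [← hgf]
  rw [integral_res_map _ hπ.measurable hg]
  simp only [← hkg]
  refine tendsto_nhds_unique (M0.tendsto_iff_forall_integral.1 hγ k hk) ?_
  refine (M0.tendsto_iff_forall_integral.1 hμ g hg).congr fun n => ?_
  rw [← h n, integral_res_map _ hπ.measurable hg]
  simp only [hkg]

theorem mem_zeroCouplings_of_tendsto [ProperSpace E] [SecondCountableTopology E] {ι : Type*}
    {l : Filter ι} [l.NeBot] {μs νs : ι → M0 E} {μ ν : M0 E} {γs : ι → M0 (E × E)}
    {γ : M0 (E × E)} (hμ : Tendsto μs l (𝓝 μ)) (hν : Tendsto νs l (𝓝 ν))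
    (hγ : Tendsto γs l (𝓝 γ)) (h : ∀ n, γs n ∈ zeroCouplings (μs n) (νs n)) :
    γ ∈ zeroCouplings μ ν :=
  ⟨M0.eq_res_map_of_tendsto hμ hγ continuous_fst rfl norm_fst_le fun n => (h n).1,
    M0.eq_res_map_of_tendsto hν hγ continuous_snd rfl norm_snd_le fun n => (h n).2⟩

/-- The product norm is a maximum, so at a point far from the origin at least one coordinate is far.
-/
theorem real_away_le_of_mem_zeroCouplings [SecondCountableTopology E] {μ ν : M0 E}
    {γ : M0 (E × E)} (h : γ ∈ zeroCouplings μ ν) {r : ℝ} (hr : 0 < r) :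
    γ.toMeasure.real (away (E × E) r) ≤
      μ.toMeasure.real (away E r) + ν.toMeasure.real (away E r) := by
  have hA : MeasurableSet {x : E | r ≤ ‖x‖} := measurableSet_le measurable_const measurable_norm
  have hsub : ∀ x : E, r ≤ ‖x‖ → x ≠ 0 := fun x hx => norm_pos_iff.1 (hr.trans_le hx)
  have e1 : μ.toMeasure (away E r) = γ.toMeasure {x | r ≤ ‖x.1.1‖ ∧ x.1.1 ≠ 0} := by
    rw [← h.1]
    exact res_map_apply γ.toMeasure measurable_fst hA
  have e2 : ν.toMeasure (away E r) = γ.toMeasure {x | r ≤ ‖x.1.2‖ ∧ x.1.2 ≠ 0} := by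
    rw [← h.2]
    exact res_map_apply γ.toMeasure measurable_snd hA
  rw [Measure.real, Measure.real, Measure.real, ← ENNReal.toReal_add
    (μ.measure_away_lt_top hr).ne (ν.measure_away_lt_top hr).ne, e1, e2]
  refine ENNReal.toReal_mono ?_ ((measure_mono fun x hx => ?_).trans (measure_union_le _ _))
  · rw [← e1, ← e2]
    exact ENNReal.add_ne_top.2 ⟨(μ.measure_away_lt_top hr).ne, (ν.measure_away_lt_top hr).ne⟩
  · exact (le_max_iff.1 (show r ≤ max ‖x.1.1‖ ‖x.1.2‖ from hx)).imp
      (fun h => ⟨h, hsub _ h⟩) fun h => ⟨h, hsub _ h⟩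

theorem exists_tendsto_of_mem_zeroCouplings [ProperSpace E] [SecondCountableTopology E]
    {ι : Type*} (𝒰 : Ultrafilter ι) {μs νs : ι → M0 E} {μ ν : M0 E} {γs : ι → M0 (E × E)}
    (hμ : Tendsto μs 𝒰 (𝓝 μ)) (hν : Tendsto νs 𝒰 (𝓝 ν))
    (h : ∀ n, γs n ∈ zeroCouplings (μs n) (νs n)) :
    ∃ γ ∈ zeroCouplings μ ν, Tendsto γs 𝒰 (𝓝 γ) := by
  have key : ∀ r > 0, ∀ a b : ℝ, μ.toMeasure.real (away E r) < a →
      ν.toMeasure.real (away E r) < b → ∀ᶠ n in (𝒰 : Filter ι),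
        (γs n).toMeasure.real (away (E × E) (2 * r)) ≤ a + b := by
    intro r hr a b ha hb
    filter_upwards [M0.eventually_real_away_le hμ hr ha, M0.eventually_real_away_le hν hr hb]
      with n h1 h2
    exact (real_away_le_of_mem_zeroCouplings (h n) (by positivity)).trans (add_le_add h1 h2)
  obtain ⟨γ, hγ⟩ := M0.exists_tendsto_of_tight 𝒰 γs
    (fun r hr => ⟨_, by
      have := key (r / 2) (half_pos hr) _ _ (lt_add_one _) (lt_add_one _)
      rwa [mul_div_cancel₀ r two_ne_zero] at this⟩)
    (fun ε hε => by
      obtain ⟨R₁, hR₁, h₁⟩ := μ.exists_real_away_lt (half_pos hε)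
      obtain ⟨R₂, hR₂, h₂⟩ := ν.exists_real_away_lt (half_pos hε)
      have hR : 0 < max R₁ R₂ := lt_max_of_lt_left hR₁
      refine ⟨2 * max R₁ R₂, by positivity, ?_⟩
      have := key (max R₁ R₂) hR (ε / 2) (ε / 2)
        ((measureReal_mono (away_anti (le_max_left _ _)) (μ.measure_away_lt_top hR₁).ne).trans_lt
          h₁)
        ((measureReal_mono (away_anti (le_max_right _ _)) (ν.measure_away_lt_top hR₂).ne).trans_lt
          h₂)
      rwa [add_halves] at this)
  exact ⟨γ, mem_zeroCouplings_of_tendsto hμ hν hγ h, hγ⟩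

theorem supp_subset_closure_fst_image [ProperSpace E] [SecondCountableTopology E] {μ ν : M0 E}
    {γ : M0 (E × E)} (h : γ ∈ zeroCouplings μ ν) :
    μ.supp ⊆ closure (Prod.fst '' γ.supp) := by
  intro x hx
  refine mem_closure_iff.2 fun W hW hxW => ?_
  have hpos := (Measure.mem_support_iff_forall x).1 hx W (hW.mem_nhds hxW)
  rw [extend, Measure.map_apply measurable_subtype_coe hW.measurableSet, ← h.1,
    zeroMarginal₁, res_map_apply _ measurable_fst hW.measurableSet] at hpos
  have hpos' : 0 < extend γ.toMeasure (Prod.fst ⁻¹' W) := by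
    rw [extend, Measure.map_apply measurable_subtype_coe (measurable_fst hW.measurableSet)]
    exact hpos.trans_le (measure_mono fun z hz => hz.1)
  obtain ⟨z, hz, hzs⟩ := Measure.nonempty_inter_support_of_pos hpos'
  exact ⟨z.1, hz, z, hzs, rfl⟩

end Couplings

end ZeroCoupling

/-! ### From ultrafilter limits to Fell convergence. -/

namespace ZeroCoupling

section FellConvergence

variable {E : Type*} [NormedAddCommGroup E]

/-- Fell convergence on `V × E` follows from the identification of all ultrafilter limits. -/
theorem fellTendsto_restrictTo {Ts : ℕ → Closeds (E × E)} {T : Closeds (E × E)} {V : Set E}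
    (h : ∀ 𝒰 : Ultrafilter ℕ, (𝒰 : Filter ℕ) ≤ atTop → ∀ p : E × E, p.1 ∈ V →
      (p ∈ lowerLimit 𝒰 (fun n => (Ts n : Set (E × E))) ↔ p ∈ T)) (hV : IsOpen V) :
    FellTendsto (fun n => restrictTo (Ts n) V) (restrictTo T V) := by
  refine fellTendsto_iff.2 ⟨fun G hG ⟨z, hzT, hzG⟩ => ?_, fun K hK hTK => ?_⟩
  · have ho : IsOpenMap (Subtype.val : ↥(V ×ˢ (Set.univ : Set E)) → E × E) :=
      (hV.prod isOpen_univ).isOpenMap_subtype_val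
    have hG' := (ho G hG).mem_nhds ⟨z, hzG, rfl⟩
    by_contra hne
    -- If the hit condition fails infinitely often, some ultrafilter finer than `atTop` concentrates
    -- on the failing indices.
    have hne' : (atTop ⊓ 𝓟 {n | ¬ ((restrictTo (Ts n) V : Set _) ∩ G).Nonempty}).NeBot :=
      frequently_iff_neBot.1 (not_eventually.1 hne)
    set 𝒰 := @Ultrafilter.of _ _ hne'
    have hle := @Ultrafilter.of_le _ _ hne'
    have h1 := (h 𝒰 (hle.trans inf_le_left) z.1 z.2.1).2 hzT _ hG'
    have h2 : ∀ᶠ n in (𝒰 : Filter ℕ), ¬ ((restrictTo (Ts n) V : Set _) ∩ G).Nonempty :=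
      le_principal_iff.1 (hle.trans inf_le_right)
    obtain ⟨n, ⟨_, hyT, y, hyG, rfl⟩, hn⟩ := (h1.and h2).exists
    exact hn ⟨y, hyT, hyG⟩
  · by_contra hne
    have hne' : (atTop ⊓ 𝓟 {n | ¬ (restrictTo (Ts n) V : Set _) ∩ K = ∅}).NeBot :=
      frequently_iff_neBot.1 (not_eventually.1 hne)
    set 𝒰 := @Ultrafilter.of _ _ hne'
    have hle := @Ultrafilter.of_le _ _ hne'
    have h2 : ∀ᶠ n in (𝒰 : Filter ℕ), ¬ (restrictTo (Ts n) V : Set _) ∩ K = ∅ :=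
      le_principal_iff.1 (hle.trans inf_le_right)
    -- The implication makes the choice total; at indices with empty intersection `0` is a dummy
    -- value.
    have h3 : ∀ n, ∃ z : E × E, ¬ (restrictTo (Ts n) V : Set _) ∩ K = ∅ →
        z ∈ (Ts n : Set (E × E)) ∩ Subtype.val '' K := by
      intro n
      by_cases hn : (restrictTo (Ts n) V : Set _) ∩ K = ∅
      · exact ⟨0, fun h => absurd hn h⟩
      · obtain ⟨y, hyT, hyK⟩ := Set.nonempty_iff_ne_empty.2 hn
        exact ⟨y.1, fun _ => ⟨hyT, y, hyK, rfl⟩⟩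
    choose z hz using h3
    obtain ⟨_, ⟨x, hxK, rfl⟩, hx, -⟩ := exists_mem_lowerLimit 𝒰
      (hK.image continuous_subtype_val) (h2.mono fun n hn => hz n hn)
    have hxT := (h 𝒰 (hle.trans inf_le_left) x.1 x.2.1).1 hx
    exact Set.eq_empty_iff_forall_notMem.1 hTK x ⟨hxT, hxK⟩

end FellConvergence

end ZeroCoupling

/-! ### The corollary. -/

theorem mainTheorem7 (d : ℕ)
    (μs νs : ℕ → ZeroCoupling.M0 (EuclideanSpace ℝ (Fin d)))
    (μ ν : ZeroCoupling.M0 (EuclideanSpace ℝ (Fin d)))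
    (hμ : Tendsto μs atTop (𝓝 μ)) (hν : Tendsto νs atTop (𝓝 ν))
    (γs : ℕ → ZeroCoupling.M0 (EuclideanSpace ℝ (Fin d) × EuclideanSpace ℝ (Fin d)))
    (hγs : ∀ n, γs n ∈ ZeroCoupling.cmZeroCouplings (μs n) (νs n))
    (Ts : ℕ → Closeds (EuclideanSpace ℝ (Fin d) × EuclideanSpace ℝ (Fin d)))
    (hTs : ∀ n, Ts n ∈ ZeroCoupling.mcmSets (EuclideanSpace ℝ (Fin d)))
    (hsupp : ∀ n, (γs n).supp ⊆ Ts n)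
    (γ : ZeroCoupling.M0 (EuclideanSpace ℝ (Fin d) × EuclideanSpace ℝ (Fin d)))
    (T : Closeds (EuclideanSpace ℝ (Fin d) × EuclideanSpace ℝ (Fin d)))
    (hT : T ∈ ZeroCoupling.mcmSets (EuclideanSpace ℝ (Fin d)))
    (hΓ : ZeroCoupling.cmZeroCouplings μ ν = {γ})
    (hγT : γ.supp ⊆ T) :
    Tendsto γs atTop (𝓝 γ) ∧
      ZeroCoupling.FellTendsto
        (fun n => ZeroCoupling.restrictTo (Ts n) (interior μ.supp))
        (ZeroCoupling.restrictTo T (interior μ.supp)) := by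
  have hγ : γ ∈ ZeroCoupling.cmZeroCouplings μ ν := hΓ ▸ Set.mem_singleton γ
  have hlim : ∀ 𝒰 : Ultrafilter ℕ, (𝒰 : Filter ℕ) ≤ atTop → Tendsto γs 𝒰 (𝓝 γ) ∧
      γ.supp ⊆ ZeroCoupling.lowerLimit 𝒰 fun n => (Ts n : Set (_ × _)) := by
    intro 𝒰 h𝒰
    obtain ⟨γ', hγ', ht⟩ := ZeroCoupling.exists_tendsto_of_mem_zeroCouplings 𝒰
      (hμ.mono_left h𝒰) (hν.mono_left h𝒰) fun n => (hγs n).1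
    have hsub : γ'.supp ⊆ ZeroCoupling.lowerLimit 𝒰 fun n => (Ts n : Set (_ × _)) := by
      intro z hz G hG
      filter_upwards [ZeroCoupling.M0.supp_subset_lowerLimit ht hz G hG] with n hn
      exact hn.mono (Set.inter_subset_inter_left G (hsupp n))
    have hcm := (ZeroCoupling.isCyclicallyMonotone_lowerLimit (𝒰 : Filter ℕ)
      fun n => (hTs n).prop).mono hsub
    -- Uniqueness makes the limit independent of the ultrafilter, so no subsequence is needed.
    have e : γ' = γ := Set.mem_singleton_iff.1 (hΓ ▸ ⟨hγ', hcm⟩)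
    exact ⟨e ▸ ht, e ▸ hsub⟩
  refine ⟨(tendsto_iff_ultrafilter _ _ _).2 fun 𝒰 h𝒰 => (hlim 𝒰 h𝒰).1,
    ZeroCoupling.fellTendsto_restrictTo (fun 𝒰 h𝒰 p hp => ?_) isOpen_interior⟩
  refine ZeroCoupling.lowerLimit_inter_eq 𝒰 hTs hT hγT (hlim 𝒰 h𝒰).2 isOpen_interior
    (fun x hx => ?_) hp
  exact hγ.2.exists_mem_of_dense Measure.isClosed_support isOpen_interior
    (interior_subset.trans (ZeroCoupling.supp_subset_closure_fst_image hγ.1)) hx
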